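/- **Conventions.** Let $G$ be a finite group with identity $e$. For $X\subseteq G$ put $\underline X=\sum_{x\in X}x\in\mathbb Z G$, $R(X)=\{(g,xg): x\in X, g\in G\}$ and $\mathrm{rad}(X)=\{g\in G: gX=Xg=X\}$. An *S-ring* over $G$ is a subring $\mathcal A\subseteq\mathbb ZG$ of the form $\mathcal A=\mathrm{Span}_{\mathbb Z}\{\underline X: X\in\mathcal S(\mathcal A)\}$, where $\mathcal S(\mathcal A)$ is a partition of $G$ with $\{e\}\in\mathcal S(\mathcal A)$ and $X^{-1}\in\mathcal S(\mathcal A)$ for all $X\in\mathcal S(\mathcal A)$; the members of $\mathcal S(\mathcal A)$ are the *basic sets*. A subgroup $U\le G$ is an *$\mathcal A$-subgroup* if $\underline U\in\mathcal A$; then $\mathcal A_U$ is the S-ring over $U$ whose basic sets are the basic sets of $\mathcal A$ contained in $U$. An *isomorphism* from $\mathcal A$ to an S-ring $\mathcal B$ over $G'$ is a bijection $f:G\to G'$ with $\{R(X)^f: X\in\mathcal S(\mathcal A)\}=\{R(Y): Y\in\mathcal S(\mathcal B)\}$, and $\mathcal A\cong\mathcal B$ means that one exists. $\mathrm{Iso}_e(\mathcal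 A)$ is the set of all $f\in\mathrm{Sym}(G)$ with $e^f=e$ that are isomorphisms from $\mathcal A$ to some S-ring over $G$, and $\mathrm{Aut}(\mathcal A)=\{f\in\mathrm{Sym}(G): R(X)^f=R(X)\text{ for all }X\in\mathcal S(\mathcal A)\}$. If $K\le\mathrm{Sym}(G)$ contains the group $G_{\mathrm{right}}$ of right multiplications, $V(K,G)$ is the S-ring whose basic sets are the orbits on $G$ of the stabilizer $K_e$; $\mathcal A$ is *schurian* if $\mathcal A=V(K,G)$ for some such $K$. For $K\le \mathrm{Sym}(G)$ and $U\le G$, $K^U$ is the group of permutations of $U$ induced by those elements of $K$ that map $U$ to itself, and, for $K=\mathrm{Aut}(\mathcal A)$, $K_{G/U}=\{\gamma\in K:(Ug)^\gamma=Ug\text{ for all }g\in G\}$. $\mathcal A$ is *decomposable* if there are $\mathcal A$-subgroups $L\le U$ with $L\ne\{e\}$, $U\neq G$, $L\trianglelefteq G$ and $L\le\mathrm{rad}(X)$ for every basic set $X\not\subseteq U$. For S-rings $\mathcal A$ over $G$ and $\mathcal B$ over $G'$, the wreath product $\mathcal A\wr\mathcal B$ is the S-ring over $G\times G'$ with basic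 sets $X\times\{e\}$ ($X\in\mathcal S(\mathcal A)$) and $G\times Y$ ($Y\in\mathcal S(\mathcal B)$, $Y\ne\{e\}$). If $G$ is an elementary abelian $p$-group of rank $n$, an *$\mathcal A$-basis* is an $n$-tuple $(a_1,\dots,a_n)$ generating $G$ such that each $\langle a_1,\dots,a_i\rangle$, $1\le i\le n$, is an $\mathcal A$-subgroup. **Lemma.** Let $p\ne q$ be primes, let $H\cong C_p^3\times C_q$ with Sylow $p$-subgroup $H_p$ and Sylow $q$-subgroup $H_q$, and let $\mathcal A$ be a schurian S-ring over $H$. Suppose that $H_p$ and $H_q$ are $\mathcal A$-subgroups, that $\mathcal A_{H_p}\cong\mathbb ZC_p\wr\mathbb ZC_p\wr\mathbb ZC_p$, and that at least one of the following holds: 1. $\mathrm{Aut}(\mathcal A)^{H_q}$ is non-solvable; 2. $V\big((\mathrm{Aut}(\mathcal A)_{H/H_p})^{H_p},H_p\big)$ is decomposable. Let $(a,b,c)$ be an $\mathcal A_{H_p}$-basis, let $H_q=\langle d\rangle$, and let $f\in\mathrm{Iso}_e(\mathcal A)$ satisfy $a^f=a$, $b^f=b$, $c^f\in\langle a\rangle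 c$ and $d^f=d$. Then $X^f=X$ for every $X\in\mathcal S(\mathcal A)$. -/

import Mathlib

open scoped Pointwise

/-- The element `∑ x ∈ X, x` of the integer group ring attached to a subset `X` of a finite group. -/
noncomputable def groupSum {G : Type*} [Group G] [Finite G] (X : Set G) : MonoidAlgebra ℤ G :=
  ∑ x ∈ X.toFinite.toFinset, MonoidAlgebra.of ℤ G x

/-- An S-ring (Schur ring) over a finite group `G`: a subring of the integer group ring `ℤG` that is
spanned over `ℤ` by the sums over the classes of a partition of `G` which contains `{1}` and is
closed under inversion. The partition (whose classes are the basic sets) is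
determined by the subring; it is recorded as part of the structure. -/
structure SRing (G : Type*) [Group G] [Finite G] extends Subring (MonoidAlgebra ℤ G) where
  basicSets : Set (Set G)
  isPartition : Setoid.IsPartition basicSets
  singleton_one_mem : {1} ∈ basicSets
  inv_mem : ∀ X ∈ basicSets, X⁻¹ ∈ basicSets
  mem_iff_mem_span : ∀ v : MonoidAlgebra ℤ G,
    v ∈ toSubring ↔ v ∈ Submodule.span ℤ (groupSum '' basicSets)

section Auxiliary

variable {G : Type*} [Group G] [Finite G]

open Classical in
theorem coeff_groupSum (X : Set G) (g : G) :
    (groupSum X).coeff g = if g ∈ X then 1 else 0 := by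
  simp [groupSum, MonoidAlgebra.coeff_sum, Finsupp.finsetSum_apply, Finsupp.single_apply]

theorem mem_span_groupSum_iff {P : Set (Set G)} (hP : Setoid.IsPartition P)
    (v : MonoidAlgebra ℤ G) :
    v ∈ Submodule.span ℤ (groupSum '' P) ↔
      ∀ X ∈ P, ∀ g ∈ X, ∀ g' ∈ X, v.coeff g = v.coeff g' := by
  classical
  have huniq : ∀ X ∈ P, ∀ Y ∈ P, ∀ g, g ∈ X → g ∈ Y → X = Y := fun X hX Y hY g hgX hgY =>
    (hP.2 g).unique ⟨hX, hgX⟩ ⟨hY, hgY⟩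
  constructor
  · intro hv
    induction hv using Submodule.span_induction with
    | mem x hx =>
      obtain ⟨Y, hY, rfl⟩ := hx
      intro X hX g hg g' hg'
      have h : g ∈ Y ↔ g' ∈ Y := by
        constructor
        · intro h
          rwa [← huniq X hX Y hY g hg h]
        · intro h
          rwa [← huniq X hX Y hY g' hg' h]
      simp [coeff_groupSum, h]
    | zero => intros; simp
    | add x y _ _ hx hy =>
      intro X hX g hg g' hg'
      simp [hx X hX g hg g' hg', hy X hX g hg g' hg']
    | smul a x _ hx =>
      intro X hX g hg g' hg'
      rw [MonoidAlgebra.coeff_smul_apply, MonoidAlgebra.coeff_smul_apply, hx X hX g hg g' hg']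
  · intro hv
    have hne : ∀ X ∈ P, X.Nonempty := fun X hX => Setoid.nonempty_of_mem_partition hP hX
    let r : Set G → G := fun X => if h : X.Nonempty then h.some else 1
    have hr : ∀ X ∈ P, r X ∈ X := fun X hX => by
      simp only [r, dif_pos (hne X hX)]
      exact (hne X hX).some_mem
    have hsum : v = ∑ X ∈ P.toFinite.toFinset, v.coeff (r X) • groupSum X := by
      ext g
      obtain ⟨X, ⟨hX, hgX⟩, -⟩ := hP.2 g
      rw [MonoidAlgebra.coeff_sum, Finsupp.finsetSum_apply, Finset.sum_eq_single X]
      · rw [MonoidAlgebra.coeff_smul_apply, coeff_groupSum, if_pos hgX,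
          hv X hX g hgX (r X) (hr X hX), smul_eq_mul, mul_one]
      · intro Y hY hYX
        have : g ∉ Y := fun h => hYX (huniq Y (by simpa using hY) X hX g h hgX)
        rw [MonoidAlgebra.coeff_smul_apply, coeff_groupSum, if_neg this, smul_zero]
      · intro h
        exact absurd (by simpa using hX) h
    rw [hsum]
    refine Submodule.sum_mem _ fun X hX => Submodule.smul_mem _ _ (Submodule.subset_span ?_)
    exact ⟨X, by simpa using hX, rfl⟩

theorem coeff_groupSum_mul (X Y : Set G) (g : G) :
    (groupSum X * groupSum Y).coeff g = ({y | y ∈ Y ∧ g * y⁻¹ ∈ X} : Set G).ncard := by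
  classical
  have := Fintype.ofFinite G
  rw [MonoidAlgebra.coeff_mul_apply_right, Finsupp.sum_fintype _ _ (by simp)]
  simp only [coeff_groupSum]
  rw [Set.ncard_eq_toFinset_card', Finset.card_eq_sum_ones, Set.toFinset_ofPred,
    Finset.sum_filter]
  push_cast
  refine Finset.sum_congr rfl fun y _ => ?_
  by_cases h1 : y ∈ Y <;> by_cases h2 : g * y⁻¹ ∈ X <;> simp [h1, h2]

end Auxiliary

namespace SRing

/-- The S-ring with a given partition into basic sets; the last hypothesis says that the product of
two class sums has coefficients that are constant on the classes. -/
noncomputable def ofPartition {G : Type*} [Group G] [Finite G] (P : Set (Set G))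
    (hP : Setoid.IsPartition P) (h1 : {1} ∈ P) (hinv : ∀ X ∈ P, X⁻¹ ∈ P)
    (hmul : ∀ X ∈ P, ∀ Y ∈ P, ∀ Z ∈ P, ∀ g ∈ Z, ∀ g' ∈ Z,
      ({y | y ∈ Y ∧ g * y⁻¹ ∈ X} : Set G).ncard = ({y | y ∈ Y ∧ g' * y⁻¹ ∈ X} : Set G).ncard) :
    SRing G where
  carrier := Submodule.span ℤ (groupSum '' P)
  mul_mem' := by
    intro u v hu hv
    have h := Submodule.mul_mem_mul hu hv
    rw [Submodule.span_mul_span] at h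
    refine Submodule.span_le.2 ?_ h
    rintro _ ⟨_, ⟨X, hX, rfl⟩, _, ⟨Y, hY, rfl⟩, rfl⟩
    refine (mem_span_groupSum_iff hP _).2 fun Z hZ g hg g' hg' => ?_
    simp only [coeff_groupSum_mul]
    exact_mod_cast hmul X hX Y hY Z hZ g hg g' hg'
  one_mem' := by
    refine Submodule.subset_span ⟨{1}, h1, ?_⟩
    have h : (Set.toFinite ({1} : Set G)).toFinset = {1} := by
      ext
      simp
    rw [groupSum, h, Finset.sum_singleton, map_one]
  add_mem' := fun hu hv => Submodule.add_mem _ hu hv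
  zero_mem' := Submodule.zero_mem _
  neg_mem' := fun hu => Submodule.neg_mem _ hu
  basicSets := P
  isPartition := hP
  singleton_one_mem := h1
  inv_mem := hinv
  mem_iff_mem_span := fun _ => Iff.rfl

section Basic

variable {G : Type*} [Group G] [Finite G]

theorem eq_of_mem (A : SRing G) {X Y : Set G} (hX : X ∈ A.basicSets) (hY : Y ∈ A.basicSets) {g : G}
    (hgX : g ∈ X) (hgY : g ∈ Y) : X = Y :=
  (A.isPartition.2 g).unique ⟨hX, hgX⟩ ⟨hY, hgY⟩

theorem ncard_eq (A : SRing G) {X Y Z : Set G} (hX : X ∈ A.basicSets) (hY : Y ∈ A.basicSets)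
    (hZ : Z ∈ A.basicSets) {g g' : G} (hg : g ∈ Z) (hg' : g' ∈ Z) :
    ({y | y ∈ Y ∧ g * y⁻¹ ∈ X} : Set G).ncard = ({y | y ∈ Y ∧ g' * y⁻¹ ∈ X} : Set G).ncard := by
  have hX' : groupSum X ∈ A.toSubring :=
    (A.mem_iff_mem_span _).2 (Submodule.subset_span ⟨X, hX, rfl⟩)
  have hY' : groupSum Y ∈ A.toSubring :=
    (A.mem_iff_mem_span _).2 (Submodule.subset_span ⟨Y, hY, rfl⟩)
  have h := (mem_span_groupSum_iff A.isPartition _).1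
    ((A.mem_iff_mem_span _).1 (mul_mem hX' hY')) Z hZ g hg g' hg'
  simp only [coeff_groupSum_mul] at h
  exact_mod_cast h

/-- `X` is an `A`-set if the sum of its elements lies in `A`. -/
def IsASet (A : SRing G) (X : Set G) : Prop :=
  groupSum X ∈ A.toSubring

/-- A subgroup is an `A`-subgroup if it is an `A`-set. -/
def IsASubgroup (A : SRing G) (U : Subgroup G) : Prop :=
  A.IsASet (U : Set G)

theorem IsASet.mem_of_mem {A : SRing G} {S X : Set G} (hS : A.IsASet S)
    (hX : X ∈ A.basicSets) {g g' : G} (hg : g ∈ X) (hg' : g' ∈ X) (h : g ∈ S) : g' ∈ S := by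
  classical
  have h' := (mem_span_groupSum_iff A.isPartition _).1
    ((A.mem_iff_mem_span _).1 hS) X hX g hg g' hg'
  by_contra hn
  simp [coeff_groupSum, h, hn] at h'

/-- The S-ring `A_U` over an `A`-subgroup `U`: its basic sets are the basic sets of `A` contained
in `U`. -/
noncomputable def restrict (A : SRing G) (U : Subgroup G) (hU : A.IsASubgroup U) : SRing U :=
  ofPartition {Y : Set U | Subtype.val '' Y ∈ A.basicSets}
    (by
      refine ⟨fun h => ?_, fun u => ?_⟩
      · simp only [Set.mem_ofPred_eq, Set.image_empty] at h
        exact A.isPartition.1 h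
      · obtain ⟨X, ⟨hX, huX⟩, -⟩ := A.isPartition.2 (u : G)
        have hXU : X ⊆ U := fun x hx => IsASet.mem_of_mem hU hX huX hx u.2
        have him : (Subtype.val '' (Subtype.val ⁻¹' X : Set U) : Set G) = X := by
          ext x
          constructor
          · rintro ⟨y, hy, rfl⟩
            exact hy
          · intro hx
            exact ⟨⟨x, hXU hx⟩, hx, rfl⟩
        refine ⟨Subtype.val ⁻¹' X, ⟨?_, huX⟩, ?_⟩
        · simpa only [Set.mem_ofPred_eq, him] using hX
        · rintro Y ⟨hY, huY⟩
          have := A.eq_of_mem hY hX (Set.mem_image_of_mem _ huY) huX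
          rw [← this, Set.preimage_image_eq _ Subtype.val_injective])
    (by simpa using A.singleton_one_mem)
    (by
      intro Y hY
      have h := A.inv_mem _ hY
      have : (Subtype.val '' Y : Set G)⁻¹ = Subtype.val '' (Y⁻¹ : Set U) :=
        (Set.image_inv U.subtype Y).symm
      rwa [this] at h)
    (by
      intro X hX Y hY Z hZ g hg g' hg'
      have key : ∀ u : U, ({y | y ∈ Y ∧ u * y⁻¹ ∈ X} : Set U).ncard =
          ({y | y ∈ Subtype.val '' Y ∧ (u : G) * y⁻¹ ∈ Subtype.val '' X} : Set G).ncard := by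
        intro u
        rw [← Set.ncard_image_of_injective _ Subtype.val_injective]
        congr 1
        ext y
        constructor
        · rintro ⟨y, ⟨hy, hu⟩, rfl⟩
          exact ⟨⟨y, hy, rfl⟩, ⟨_, hu, rfl⟩⟩
        · rintro ⟨⟨y, hy, rfl⟩, ⟨x, hx, hxy⟩⟩
          refine ⟨y, ⟨hy, ?_⟩, rfl⟩
          have : u * y⁻¹ = x := Subtype.ext hxy.symm
          rwa [this]
      rw [key, key]
      exact A.ncard_eq hX hY hZ (Set.mem_image_of_mem _ hg) (Set.mem_image_of_mem _ hg'))

variable (G) in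
/-- The full group ring `ℤG`, all of whose basic sets are singletons. -/
noncomputable def full : SRing G :=
  ofPartition (Set.range fun g : G => ({g} : Set G))
    (by
      refine ⟨?_, fun g => ⟨{g}, ⟨⟨g, rfl⟩, rfl⟩, ?_⟩⟩
      · rintro ⟨g, hg⟩
        exact Set.singleton_ne_empty g hg
      · rintro _ ⟨⟨h, rfl⟩, hg⟩
        simp only [Set.mem_singleton_iff] at hg
        simp [hg])
    ⟨1, rfl⟩
    (by rintro _ ⟨g, rfl⟩; exact ⟨g⁻¹, by simp⟩)
    (by
      rintro X - Y - _ ⟨z, rfl⟩ g hg g' hg'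
      rw [Set.mem_singleton_iff.1 hg, Set.mem_singleton_iff.1 hg'])

/-- The wreath product `A ≀ B` over `G × G'`: inside the first factor the basic sets are those of
`A`, and outside it they are the full preimages of the nontrivial basic sets of `B`. -/
noncomputable def wreath {G' : Type*} [Group G'] [Finite G'] (A : SRing G) (B : SRing G') :
    SRing (G × G') :=
  ofPartition
    ({S | ∃ X ∈ A.basicSets, S = X ×ˢ ({1} : Set G')} ∪
      {S | ∃ Y ∈ B.basicSets, Y ≠ {1} ∧ S = (Set.univ : Set G) ×ˢ Y})
    (by
      have hB1 : ∀ Y ∈ B.basicSets, Y ≠ {1} → (1 : G') ∉ Y := fun Y hY hne h =>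
        hne (B.eq_of_mem hY B.singleton_one_mem h rfl)
      refine ⟨?_, ?_⟩
      · rintro (⟨X, hX, h⟩ | ⟨Y, hY, -, h⟩)
        · obtain ⟨x, hx⟩ := Setoid.nonempty_of_mem_partition A.isPartition hX
          have : (x, (1 : G')) ∈ (∅ : Set (G × G')) := h ▸ ⟨hx, rfl⟩
          exact this
        · obtain ⟨y, hy⟩ := Setoid.nonempty_of_mem_partition B.isPartition hY
          have : ((1 : G), y) ∈ (∅ : Set (G × G')) := h ▸ ⟨trivial, hy⟩
          exact this
      · rintro ⟨g, h⟩
        by_cases hh : h = 1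
        · subst hh
          obtain ⟨X, ⟨hX, hgX⟩, -⟩ := A.isPartition.2 g
          refine ⟨X ×ˢ {1}, ⟨Or.inl ⟨X, hX, rfl⟩, ⟨hgX, rfl⟩⟩, ?_⟩
          rintro S ⟨⟨X', hX', rfl⟩ | ⟨Y, hY, hne, rfl⟩, hS⟩
          · rw [A.eq_of_mem hX' hX hS.1 hgX]
          · exact absurd hS.2 (hB1 Y hY hne)
        · obtain ⟨Y, ⟨hY, hhY⟩, -⟩ := B.isPartition.2 h
          refine ⟨Set.univ ×ˢ Y, ⟨Or.inr ⟨Y, hY, ?_, rfl⟩, ⟨trivial, hhY⟩⟩, ?_⟩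
          · rintro rfl
            exact hh hhY
          · rintro S ⟨⟨X', hX', rfl⟩ | ⟨Y', hY', hne, rfl⟩, hS⟩
            · exact absurd hS.2 hh
            · rw [B.eq_of_mem hY' hY hS.2 hhY])
    (Or.inl ⟨{1}, A.singleton_one_mem, by rw [Set.singleton_prod_singleton]; rfl⟩)
    (by
      rintro S (⟨X, hX, rfl⟩ | ⟨Y, hY, hne, rfl⟩)
      · refine Or.inl ⟨X⁻¹, A.inv_mem X hX, ?_⟩
        ext ⟨g, h⟩
        simp
      · refine Or.inr ⟨Y⁻¹, B.inv_mem Y hY, ?_, ?_⟩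
        · intro h
          apply hne
          rw [← inv_inv Y, h]
          simp
        · ext ⟨g, h⟩
          simp)
    (by
      have hcls : ∀ Z ∈ ({S | ∃ X ∈ A.basicSets, S = X ×ˢ ({1} : Set G')} ∪
          {S | ∃ Y ∈ B.basicSets, Y ≠ {1} ∧ S = (Set.univ : Set G) ×ˢ Y} : Set (Set (G × G'))),
          ∀ z ∈ Z, ∀ z' ∈ Z, (∃ Y ∈ B.basicSets, z.2 ∈ Y ∧ z'.2 ∈ Y) ∧
            (z.2 = 1 → ∃ X ∈ A.basicSets, z.1 ∈ X ∧ z'.1 ∈ X) := by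
        rintro Z (⟨X, hX, rfl⟩ | ⟨Y, hY, hne, rfl⟩) ⟨g, h⟩ ⟨hg, hh⟩ ⟨g', h'⟩ ⟨hg', hh'⟩
        · exact ⟨⟨{1}, B.singleton_one_mem, hh, hh'⟩, fun _ => ⟨X, hX, hg, hg'⟩⟩
        · refine ⟨⟨Y, hY, hh, hh'⟩, fun h1 => ?_⟩
          simp only at h1 hh
          rw [h1] at hh
          exact absurd (B.eq_of_mem hY B.singleton_one_mem hh rfl) hne
      intro S hS T hT Z hZ z hz z' hz'
      obtain ⟨⟨W, hW, hzW, hzW'⟩, hA⟩ := hcls Z hZ z hz z' hz'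
      obtain ⟨g, h⟩ := z
      obtain ⟨g', h'⟩ := z'
      simp only at hzW hzW' hA
      have hiff : ∀ Y ∈ B.basicSets, h ∈ Y ↔ h' ∈ Y := fun Y hY =>
        ⟨fun hy => B.eq_of_mem hW hY hzW hy ▸ hzW', fun hy => B.eq_of_mem hW hY hzW' hy ▸ hzW⟩
      have hone : h = 1 ↔ h' = 1 := hiff {1} B.singleton_one_mem
      rcases hS with ⟨X₁, hX₁, rfl⟩ | ⟨Y₁, hY₁, hne₁, rfl⟩ <;>
        rcases hT with ⟨X₂, hX₂, rfl⟩ | ⟨Y₂, hY₂, hne₂, rfl⟩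
      · have key : ∀ (k : G) (l : G'), l = 1 →
            ({y | y ∈ X₂ ×ˢ ({1} : Set G') ∧ (k, l) * y⁻¹ ∈ X₁ ×ˢ ({1} : Set G')} :
              Set (G × G')).ncard = ({y | y ∈ X₂ ∧ k * y⁻¹ ∈ X₁} : Set G).ncard := by
          rintro k l rfl
          have : ({y | y ∈ X₂ ×ˢ ({1} : Set G') ∧ (k, (1 : G')) * y⁻¹ ∈ X₁ ×ˢ ({1} : Set G')} :
              Set (G × G')) = ({y | y ∈ X₂ ∧ k * y⁻¹ ∈ X₁} : Set G) ×ˢ ({1} : Set G') := by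
            ext ⟨x, y⟩
            simp
            tauto
          rw [this, Set.ncard_prod]
          simp
        have key' : ∀ (k : G) (l : G'), l ≠ 1 →
            ({y | y ∈ X₂ ×ˢ ({1} : Set G') ∧ (k, l) * y⁻¹ ∈ X₁ ×ˢ ({1} : Set G')} :
              Set (G × G')) = ∅ := by
          intro k l hl
          ext ⟨x, y⟩
          simp only [Set.mem_ofPred_eq, Set.mem_prod, Set.mem_singleton_iff, Prod.inv_mk,
            Prod.mk_mul_mk, Set.mem_empty_iff_false, iff_false]
          rintro ⟨⟨-, rfl⟩, -, hl'⟩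
          simp at hl'
          exact hl hl'
        by_cases h1 : h = 1
        · obtain ⟨X, hX, hgX, hgX'⟩ := hA h1
          rw [key g h h1, key g' h' (hone.1 h1)]
          exact A.ncard_eq hX₁ hX₂ hX hgX hgX'
        · rw [key' g h h1, key' g' h' (fun e => h1 (hone.2 e))]
      · have key : ∀ (k : G) (l : G'),
            ({y | y ∈ (Set.univ : Set G) ×ˢ Y₂ ∧ (k, l) * y⁻¹ ∈ X₁ ×ˢ ({1} : Set G')} :
              Set (G × G')).ncard = X₁.ncard * (Y₂ ∩ {l}).ncard := by
          intro k l
          have : ({y | y ∈ (Set.univ : Set G) ×ˢ Y₂ ∧ (k, l) * y⁻¹ ∈ X₁ ×ˢ ({1} : Set G')} :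
              Set (G × G')) = ((fun x => x⁻¹ * k) '' X₁) ×ˢ (Y₂ ∩ {l}) := by
            ext ⟨x, y⟩
            simp only [Set.mem_ofPred_eq, Set.mem_prod, Set.mem_univ, true_and, Prod.inv_mk,
              Prod.mk_mul_mk, Set.mem_singleton_iff, Set.mem_image, Set.mem_inter_iff,
              mul_inv_eq_one]
            constructor
            · rintro ⟨hy, hx, rfl⟩
              exact ⟨⟨_, hx, by group⟩, hy, rfl⟩
            · rintro ⟨⟨w, hw, rfl⟩, hy, rfl⟩
              exact ⟨hy, by simpa using hw, rfl⟩
          rw [this, Set.ncard_prod, Set.ncard_image_of_injective]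
          intro x x' hx
          simpa using hx
        rw [key, key]
        congr 1
        by_cases hy : h ∈ Y₂
        · have hy' := (hiff Y₂ hY₂).1 hy
          rw [Set.inter_eq_right.2 (by simpa using hy), Set.inter_eq_right.2 (by simpa using hy')]
          simp
        · have hy' := fun e => hy ((hiff Y₂ hY₂).2 e)
          rw [Set.inter_singleton_eq_empty.2 hy, Set.inter_singleton_eq_empty.2 hy']
      · have key : ∀ (k : G) (l : G'),
            ({y | y ∈ X₂ ×ˢ ({1} : Set G') ∧ (k, l) * y⁻¹ ∈ (Set.univ : Set G) ×ˢ Y₁} :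
              Set (G × G')) = {y | y ∈ X₂ ×ˢ ({1} : Set G') ∧ l ∈ Y₁} := by
          intro k l
          ext ⟨x, y⟩
          simp only [Set.mem_ofPred_eq, Set.mem_prod, Set.mem_univ, true_and, Prod.inv_mk,
            Prod.mk_mul_mk, Set.mem_singleton_iff]
          constructor
          · rintro ⟨⟨hx, rfl⟩, hl⟩
            exact ⟨⟨hx, rfl⟩, by simpa using hl⟩
          · rintro ⟨⟨hx, rfl⟩, hl⟩
            exact ⟨⟨hx, rfl⟩, by simpa using hl⟩
        rw [key, key]
        simp only [hiff Y₁ hY₁]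
      · have key : ∀ (k : G) (l : G'),
            ({y | y ∈ (Set.univ : Set G) ×ˢ Y₂ ∧ (k, l) * y⁻¹ ∈ (Set.univ : Set G) ×ˢ Y₁} :
              Set (G × G')) = (Set.univ : Set G) ×ˢ {y | y ∈ Y₂ ∧ l * y⁻¹ ∈ Y₁} := by
          intro k l
          ext ⟨x, y⟩
          simp
        rw [key, key, Set.ncard_prod, Set.ncard_prod]
        congr 1
        exact B.ncard_eq hY₁ hY₂ hW hzW hzW')

end Basic

/-- The arc set `{(g, xg) : x ∈ X, g ∈ G}` of the Cayley digraph of `G` with connection set `X`. -/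
def arcs {G : Type*} [Group G] (X : Set G) : Set (G × G) :=
  {e | ∃ x ∈ X, ∃ g : G, e = (g, x * g)}

/-- A bijection `f : G → G'` is an isomorphism from `A` to `B` if it maps the set of arc sets of
basic sets of `A` onto that of `B`. -/
def IsIso {G G' : Type*} [Group G] [Finite G] [Group G'] [Finite G'] (A : SRing G) (B : SRing G')
    (f : G ≃ G') : Prop :=
  (fun X => Prod.map f f '' arcs X) '' A.basicSets = arcs '' B.basicSets

/-- `A ≅ B`. -/
def Isomorphic {G G' : Type*} [Group G] [Finite G] [Group G'] [Finite G'] (A : SRing G)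
    (B : SRing G') : Prop :=
  ∃ f : G ≃ G', IsIso A B f

section Group

variable {G : Type*} [Group G] [Finite G]

/-- `Iso_e(A)`: the permutations of `G` fixing the identity that are
isomorphisms from `A` onto some S-ring over `G`. -/
def isoOne (A : SRing G) : Set (Equiv.Perm G) :=
  {f | (∃ B : SRing G, IsIso A B f) ∧ f 1 = 1}

/-- `Aut(A)`: the permutations of `G` that preserve the arc set of every basic set. -/
def aut (A : SRing G) : Subgroup (Equiv.Perm G) where
  carrier := {f | ∀ X ∈ A.basicSets, Prod.map f f '' arcs X = arcs X}
  one_mem' := by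
    intro X _
    simp
  mul_mem' := by
    intro f f' hf hf' X hX
    have h : (Prod.map (f * f' : Equiv.Perm G) (f * f' : Equiv.Perm G) : G × G → G × G) =
        Prod.map f f ∘ Prod.map f' f' := rfl
    rw [h, Set.image_comp, hf' X hX, hf X hX]
  inv_mem' := by
    intro f hf X hX
    conv_lhs => rw [← hf X hX]
    rw [← Set.image_comp]
    have h : (Prod.map (f⁻¹ : Equiv.Perm G) (f⁻¹ : Equiv.Perm G) ∘ Prod.map f f : G × G → G × G)
        = id := by
      funext e
      exact Prod.ext (Equiv.symm_apply_apply f e.1) (Equiv.symm_apply_apply f e.2)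
    rw [h, Set.image_id]

end Group

end SRing

/-- The group of right multiplications of `G`. -/
def rightMultiplications (G : Type*) [Group G] : Subgroup (Equiv.Perm G) where
  carrier := Set.range fun g : G => Equiv.mulRight g
  one_mem' := ⟨1, by ext; simp⟩
  mul_mem' := by
    rintro _ _ ⟨g, rfl⟩ ⟨h, rfl⟩
    exact ⟨h * g, by ext; simp [mul_assoc]⟩
  inv_mem' := by
    rintro _ ⟨g, rfl⟩
    exact ⟨g⁻¹, by ext; simp⟩

/-- The group `K^U` of permutations of a subgroup `U` induced by the elements of `K` that map `U`
to itself. -/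
def inducedGroup {G : Type*} [Group G] (K : Subgroup (Equiv.Perm G)) (U : Subgroup G) :
    Subgroup (Equiv.Perm U) where
  carrier := {s | ∃ f ∈ K, ∀ u : U, f (u : G) = (s u : U)}
  one_mem' := ⟨1, K.one_mem, fun _ => rfl⟩
  mul_mem' := by
    rintro s t ⟨f, hf, hfs⟩ ⟨k, hk, hkt⟩
    exact ⟨f * k, K.mul_mem hf hk, fun u => by simp [hkt, hfs]⟩
  inv_mem' := by
    rintro s ⟨f, hf, hfs⟩
    refine ⟨f⁻¹, K.inv_mem hf, fun u => ?_⟩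
    rw [Equiv.Perm.inv_eq_iff_eq, hfs]
    simp

/-- The kernel of the action of `K` on the right cosets of `L`: the elements of `K` that map every
coset `Lg` to itself. -/
def cosetKernel {G : Type*} [Group G] (K : Subgroup (Equiv.Perm G)) (L : Subgroup G) :
    Subgroup (Equiv.Perm G) where
  carrier := {f | f ∈ K ∧ ∀ g : G, f '' (MulOpposite.op g • (L : Set G)) =
    MulOpposite.op g • (L : Set G)}
  one_mem' := ⟨K.one_mem, fun g => by simp⟩
  mul_mem' := by
    rintro f k ⟨hf, hf'⟩ ⟨hk, hk'⟩
    refine ⟨K.mul_mem hf hk, fun g => ?_⟩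
    rw [Equiv.Perm.coe_mul, Set.image_comp, hk', hf']
  inv_mem' := by
    rintro f ⟨hf, hf'⟩
    refine ⟨K.inv_mem hf, fun g => ?_⟩
    conv_lhs => rw [← hf' g]
    rw [← Set.image_comp]
    simp

namespace SRing

variable {G : Type*} [Group G] [Finite G]

/-- Schur's S-ring `V(K, G)` of a permutation group `K` containing all right multiplications: its
basic sets are the orbits on `G` of the stabilizer of the identity in `K`. -/
noncomputable def transitivityModule (K : Subgroup (Equiv.Perm G))
    (hK : rightMultiplications G ≤ K) : SRing G :=
  ofPartition (Set.range fun g : G => MulAction.orbit (MulAction.stabilizer K (1 : G)) g)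
    (by
      refine ⟨?_, fun g => ⟨_, ⟨⟨g, rfl⟩, MulAction.mem_orbit_self g⟩, ?_⟩⟩
      · rintro ⟨g, hg⟩
        exact (MulAction.nonempty_orbit g).ne_empty hg
      · rintro _ ⟨⟨h, rfl⟩, hg⟩
        exact (MulAction.orbit_eq_iff.2 hg).symm)
    (by
      refine ⟨1, ?_⟩
      ext g
      simp only [MulAction.mem_orbit_iff, Set.mem_singleton_iff]
      constructor
      · rintro ⟨k, rfl⟩
        exact k.2
      · rintro rfl
        exact ⟨1, one_smul _ _⟩)
    (by
      have key : ∀ g y : G, y ∈ MulAction.orbit (MulAction.stabilizer K (1 : G)) g →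
          y⁻¹ ∈ MulAction.orbit (MulAction.stabilizer K (1 : G)) g⁻¹ := by
        rintro g _ ⟨⟨⟨k, hkK⟩, hk⟩, rfl⟩
        have hk1 : k 1 = 1 := hk
        refine ⟨⟨⟨Equiv.mulRight (k g)⁻¹ * k * Equiv.mulRight g,
          K.mul_mem (K.mul_mem (hK ⟨_, rfl⟩) hkK) (hK ⟨_, rfl⟩)⟩, ?_⟩, ?_⟩
        · change k (1 * g) * (k g)⁻¹ = 1
          simp
        · change k (g⁻¹ * g) * (k g)⁻¹ = (k g)⁻¹
          simp [hk1]
      rintro _ ⟨g, rfl⟩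
      refine ⟨g⁻¹, ?_⟩
      ext y
      constructor
      · intro hy
        simpa using key _ _ hy
      · intro hy
        simpa using key _ _ (Set.mem_inv.1 hy))
    (by
      rintro _ ⟨a, rfl⟩ _ ⟨b, rfl⟩ _ ⟨c, rfl⟩ g hg g' hg'
      have key : ∀ (k : MulAction.stabilizer K (1 : G)) (g : G),
          ({y | y ∈ MulAction.orbit (MulAction.stabilizer K (1 : G)) b ∧
            g * y⁻¹ ∈ MulAction.orbit (MulAction.stabilizer K (1 : G)) a} : Set G).ncard ≤
          ({y | y ∈ MulAction.orbit (MulAction.stabilizer K (1 : G)) b ∧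
            (k • g) * y⁻¹ ∈ MulAction.orbit (MulAction.stabilizer K (1 : G)) a} : Set G).ncard := by
        intro k g
        rw [← Set.ncard_image_of_injective _ (MulAction.injective k)]
        refine Set.ncard_le_ncard ?_
        rintro _ ⟨y, ⟨hyb, hya⟩, rfl⟩
        refine ⟨(MulAction.mem_orbit_of_mem_orbit k hyb), ?_⟩
        obtain ⟨⟨k, hkK⟩, hk⟩ := k
        have hk1 : k 1 = 1 := hk
        change k g * (k y)⁻¹ ∈ _
        have hmem : Equiv.mulRight (k y)⁻¹ * k * Equiv.mulRight y ∈ K :=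
          K.mul_mem (K.mul_mem (hK ⟨_, rfl⟩) hkK) (hK ⟨_, rfl⟩)
        have hst : (⟨_, hmem⟩ : K) ∈ MulAction.stabilizer K (1 : G) := by
          change k (1 * y) * (k y)⁻¹ = 1
          simp
        have := MulAction.mem_orbit_of_mem_orbit
          (⟨⟨_, hmem⟩, hst⟩ : MulAction.stabilizer K (1 : G)) hya
        have he : (⟨⟨_, hmem⟩, hst⟩ : MulAction.stabilizer K (1 : G)) • (g * y⁻¹) =
            k g * (k y)⁻¹ := by
          change k (g * y⁻¹ * y) * (k y)⁻¹ = _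
          simp
        rwa [he] at this
      have hgg : g' ∈ MulAction.orbit (MulAction.stabilizer K (1 : G)) g := by
        rw [MulAction.orbit_eq_iff.2 hg]
        exact hg'
      obtain ⟨k, rfl⟩ := hgg
      refine le_antisymm (key k g) ?_
      have := key k⁻¹ (k • g)
      rwa [inv_smul_smul] at this)

/-- `A` is schurian if `A = V(K, G)` for some permutation group `K` of `G` containing all right
multiplications. -/
def IsSchurian (A : SRing G) : Prop :=
  ∃ (K : Subgroup (Equiv.Perm G)) (hK : rightMultiplications G ≤ K), A = transitivityModule K hK

/-- The radical `{g : gX = Xg = X}` of a set. -/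
def rad (X : Set G) : Set G :=
  {g | g • X = X ∧ MulOpposite.op g • X = X}

/-- `A` is the `U/L`-wreath product (generalized wreath product): `L ≤ U` are `A`-subgroups, `L` is
normal in `G`, and `L` lies in the radical of every basic set outside `U`. -/
def IsGeneralizedWreath (A : SRing G) (U L : Subgroup G) : Prop :=
  A.IsASubgroup U ∧ A.IsASubgroup L ∧ L ≤ U ∧ L.Normal ∧
    ∀ X ∈ A.basicSets, ¬ X ⊆ U → (L : Set G) ⊆ rad X

/-- `A` is decomposable if it is a nontrivial generalized wreath product. -/
def IsDecomposable (A : SRing G) : Prop :=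
  ∃ U L : Subgroup G, A.IsGeneralizedWreath U L ∧ L ≠ ⊥ ∧ U ≠ ⊤

/-- An `A`-basis of an elementary abelian `p`-group of rank `n`: a generating `n`-tuple all of whose
initial segments generate `A`-subgroups. -/
def IsABasis {n : ℕ} (A : SRing G) (v : Fin n → G) : Prop :=
  Subgroup.closure (Set.range v) = ⊤ ∧
    ∀ i, A.IsASubgroup (Subgroup.closure (v '' Set.Iic i))

end SRing

theorem rightMultiplications_le_aut {G : Type*} [Group G] [Finite G] (A : SRing G) :
    rightMultiplications G ≤ A.aut := by
  rintro _ ⟨h, rfl⟩ X _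
  ext ⟨a, b⟩
  constructor
  · rintro ⟨_, ⟨x, hx, g, rfl⟩, he⟩
    refine ⟨x, hx, g * h, ?_⟩
    rw [← he]
    simp [mul_assoc]
  · rintro ⟨x, hx, g, he⟩
    refine ⟨(g * h⁻¹, x * (g * h⁻¹)), ⟨x, hx, _, rfl⟩, ?_⟩
    rw [he]
    simp [mul_assoc]

theorem rightMultiplications_le_inducedGroup_cosetKernel {G : Type*} [CommGroup G]
    {K : Subgroup (Equiv.Perm G)} (hK : rightMultiplications G ≤ K) (L : Subgroup G) :
    rightMultiplications L ≤ inducedGroup (cosetKernel K L) L := by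
  rintro _ ⟨l, rfl⟩
  refine ⟨Equiv.mulRight (l : G), ⟨hK ⟨_, rfl⟩, fun g => ?_⟩, fun u => by simp⟩
  have hmem : ∀ x : G, x ∈ MulOpposite.op g • (L : Set G) ↔ x * g⁻¹ ∈ L := fun x => by
    rw [Set.mem_smul_set_iff_inv_smul_mem]
    rfl
  ext x
  rw [hmem]
  constructor
  · rintro ⟨y, hy, rfl⟩
    have := L.mul_mem ((hmem y).1 hy) l.2
    rwa [mul_right_comm] at this
  · intro hx
    refine ⟨x * (l : G)⁻¹, (hmem _).2 ?_, by simp⟩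
    rw [mul_right_comm]
    exact L.mul_mem hx (L.inv_mem l.2)

/-- The cyclic group `C_n`, written multiplicatively. -/
abbrev Cyc (n : ℕ) : Type := Multiplicative (ZMod n)

/-! Write `P` and `Q` for the Sylow subgroups, `L = ⟨a⟩` and `M = ⟨a, b⟩`. Comparing sizes of basic
sets with those of the iterated wreath product shows that the basic sets in `P` are the points of
`L`, the `L`-cosets in `M \ L` and the `M`-cosets in `P \ M`. A normalized isomorphism `f` satisfies
`f(ST) = f(S)f(T)` for every `A`-set `S`. Hence it preserves all these cosets, since it does so for
those of `a`, `b`, `c`, and `f(hx) = f(h)f(x)` for `h ∈ P`, `x ∈ Q`. By Schur's theorem on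
multipliers it also commutes with `m`-th powers of `A`-sets for `m` coprime to `|H|`. As `m` can be
prescribed independently on `P` and on `Q`, only the basic sets of elements `vd` have to be treated.

If `Aut(A)` induces a non-solvable group on `Q`, consider the normal subgroup of automorphisms
preserving each `Q`-coset. Its quotient is a `p`-group and it acts faithfully on `Q`. Were the
stabilizer of `1` in it not transitive on `Q \ {1}`, it would act on `Q` by affine maps
(`exists_affine_of_image_sub_eq`, a form of Burnside's theorem on groups of prime degree, proved
with finite differences of polynomials), and `Aut(A)` would be solvable. So it is transitive
(`mul_mem_cell_of_not_isSolvable`), the basic set of `hx` is the product of those of `h` and `x`,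
and `f` preserves it.

If the S-ring in the second condition is decomposable, the basic sets of `vd` with `v ∈ P \ M` are
`L`-invariant (`mul_cell_eq_of_isDecomposable`): otherwise a commutator-like product of
automorphisms would move a point of `P \ M` by `a` while fixing `Q` pointwise. This invariance
absorbs the uncertainty `f(c) ∈ Lc`. The elements of such a basic set have the form `yvx` with `y ∈
M`, `x ∈ Q`, and a multiplier taking `vd` to `vx` shows that `f` of the set contains each of them
(`image_cell_mul_eq`). The same argument with smaller subgroups handles `v ∈ M`. -/

namespace SRing

/-! ### Basic sets as cells, and products of `A`-sets -/

section Cells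

variable {G : Type*} [Group G] [Finite G]

/-- The basic set containing a given element. -/
noncomputable def cell (A : SRing G) (g : G) : Set G :=
  (A.isPartition.2 g).choose

variable {A : SRing G}

theorem cell_mem_basicSets (A : SRing G) (g : G) : A.cell g ∈ A.basicSets :=
  (A.isPartition.2 g).choose_spec.1.1

theorem mem_cell_self (A : SRing G) (g : G) : g ∈ A.cell g :=
  (A.isPartition.2 g).choose_spec.1.2

theorem cell_eq_of_mem {X : Set G} (hX : X ∈ A.basicSets) {g : G} (hg : g ∈ X) : A.cell g = X :=
  A.eq_of_mem (A.cell_mem_basicSets g) hX (A.mem_cell_self g) hg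

theorem cell_eq_cell {g h : G} (hh : h ∈ A.cell g) : A.cell h = A.cell g :=
  cell_eq_of_mem (A.cell_mem_basicSets g) hh

theorem mem_cell_comm {g h : G} : h ∈ A.cell g ↔ g ∈ A.cell h :=
  ⟨fun hh => cell_eq_cell hh ▸ A.mem_cell_self g, fun hh => cell_eq_cell hh ▸ A.mem_cell_self h⟩

theorem mem_cell_iff_cell_eq {g h : G} : h ∈ A.cell g ↔ A.cell h = A.cell g :=
  ⟨cell_eq_cell, fun e => e ▸ A.mem_cell_self h⟩

theorem mem_basicSets_iff_exists_cell {X : Set G} : X ∈ A.basicSets ↔ ∃ g, X = A.cell g := by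
  constructor
  · intro hX
    obtain ⟨g, hg⟩ := Setoid.nonempty_of_mem_partition A.isPartition hX
    exact ⟨g, (cell_eq_of_mem hX hg).symm⟩
  · rintro ⟨g, rfl⟩
    exact A.cell_mem_basicSets g

theorem isASet_iff_coeff {S : Set G} : A.IsASet S ↔
    ∀ X ∈ A.basicSets, ∀ g ∈ X, ∀ g' ∈ X, (groupSum S).coeff g = (groupSum S).coeff g' := by
  rw [IsASet, A.mem_iff_mem_span, mem_span_groupSum_iff A.isPartition]

theorem isASet_iff {S : Set G} : A.IsASet S ↔ ∀ g ∈ S, A.cell g ⊆ S := by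
  classical
  constructor
  · intro hS g hg x hx
    exact hS.mem_of_mem (A.cell_mem_basicSets g) (A.mem_cell_self g) hx hg
  · intro h
    refine isASet_iff_coeff.2 fun X hX g hg g' hg' => ?_
    have hiff : g ∈ S ↔ g' ∈ S := by
      constructor
      · intro hS
        exact h g hS (by rwa [cell_eq_of_mem hX hg])
      · intro hS
        exact h g' hS (by rwa [cell_eq_of_mem hX hg'])
    simp [coeff_groupSum, hiff]

theorem IsASet.cell_subset {S : Set G} (hS : A.IsASet S) {g : G} (hg : g ∈ S) : A.cell g ⊆ S :=
  isASet_iff.1 hS g hg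

theorem isASet_of_mem_basicSets {X : Set G} (hX : X ∈ A.basicSets) : A.IsASet X :=
  isASet_iff.2 fun _ hg => (cell_eq_of_mem hX hg).subset

theorem isASet_cell (A : SRing G) (g : G) : A.IsASet (A.cell g) :=
  isASet_of_mem_basicSets (A.cell_mem_basicSets g)

/-- The coefficients of the product of the two sums count factorizations, so `S * T` is the support
of an element of `A`. -/
theorem IsASet.mul {S T : Set G} (hS : A.IsASet S) (hT : A.IsASet T) : A.IsASet (S * T) := by
  have hST : groupSum S * groupSum T ∈ A.toSubring := mul_mem hS hT
  rw [A.mem_iff_mem_span, mem_span_groupSum_iff A.isPartition] at hST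
  refine isASet_iff.2 fun g hg x hx => ?_
  have h := hST _ (A.cell_mem_basicSets g) g (A.mem_cell_self g) x hx
  rw [coeff_groupSum_mul, coeff_groupSum_mul, Nat.cast_inj] at h
  have key : ∀ w : G, w ∈ S * T ↔ ({y | y ∈ T ∧ w * y⁻¹ ∈ S} : Set G).Nonempty := by
    intro w
    constructor
    · rintro ⟨s, hs, t, ht, rfl⟩
      exact ⟨t, ht, by simpa using hs⟩
    · rintro ⟨t, ht, hs⟩
      exact ⟨_, hs, t, ht, by simp⟩
  rw [key, ← Set.ncard_pos] at hg ⊢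
  omega

theorem isASet_one (A : SRing G) : A.IsASet 1 :=
  isASet_of_mem_basicSets A.singleton_one_mem

end Cells

/-! ### Isomorphisms and automorphisms acting on `A`-sets -/

section Arcs

variable {G : Type*} [Group G]

theorem mk_mem_arcs {X : Set G} {g h : G} : (g, h) ∈ arcs X ↔ h * g⁻¹ ∈ X := by
  constructor
  · rintro ⟨x, hx, k, e⟩
    obtain ⟨rfl, rfl⟩ := Prod.mk.inj e
    simpa using hx
  · intro hx
    exact ⟨_, hx, g, by simp⟩

theorem mk_mem_image_arcs {G' : Type*} (f : G ≃ G') {X : Set G} {g h : G} :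
    (f g, f h) ∈ Prod.map f f '' arcs X ↔ h * g⁻¹ ∈ X := by
  rw [← mk_mem_arcs]
  exact (Function.Injective.prodMap f.injective f.injective).mem_set_image (a := (g, h))

end Arcs

section Iso

variable {G G' : Type*} [Group G] [Finite G] [Group G'] [Finite G'] {A : SRing G} {B : SRing G'}

theorem IsIso.exists_basicSet {f : G ≃ G'} (hf : IsIso A B f) {X : Set G} (hX : X ∈ A.basicSets) :
    ∃ Y ∈ B.basicSets, ∀ g h : G, h * g⁻¹ ∈ X ↔ f h * (f g)⁻¹ ∈ Y := by
  have h : Prod.map f f '' arcs X ∈ arcs '' B.basicSets := hf ▸ ⟨X, hX, rfl⟩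
  obtain ⟨Y, hY, e⟩ := h
  refine ⟨Y, hY, fun g h => ?_⟩
  rw [← mk_mem_image_arcs f, ← e, mk_mem_arcs]

theorem IsIso.cell_eq_cell_iff {f : G ≃ G'} (hf : IsIso A B f) (g h g' h' : G) :
    A.cell (h * g⁻¹) = A.cell (h' * g'⁻¹) ↔
      B.cell (f h * (f g)⁻¹) = B.cell (f h' * (f g')⁻¹) := by
  obtain ⟨Y, hY, hXY⟩ := hf.exists_basicSet (A.cell_mem_basicSets (h * g⁻¹))
  have e := cell_eq_of_mem hY ((hXY g h).1 (A.mem_cell_self _))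
  rw [eq_comm, ← mem_cell_iff_cell_eq, hXY, eq_comm, ← mem_cell_iff_cell_eq, e]

/-- The size of a basic set is the valency of its Cayley digraph, which an isomorphism preserves. -/
theorem IsIso.ncard_cell {f : G ≃ G'} (hf : IsIso A B f) (g h : G) :
    (A.cell (h * g⁻¹)).ncard = (B.cell (f h * (f g)⁻¹)).ncard := by
  obtain ⟨Y, hY, hXY⟩ := hf.exists_basicSet (A.cell_mem_basicSets (h * g⁻¹))
  rw [cell_eq_of_mem hY ((hXY g h).1 (A.mem_cell_self _))]
  refine Set.ncard_congr (fun x _ => f (x * g) * (f g)⁻¹) ?_ ?_ ?_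
  · intro x hx
    exact (hXY _ _).1 (by simpa using hx)
  · intro x y _ _ e
    simpa using e
  · intro y hy
    refine ⟨f.symm (y * f g) * g⁻¹, (hXY _ _).2 (by simpa using hy), by simp⟩

end Iso

section Perm

variable {G : Type*} [Group G] [Finite G] {A : SRing G} {f : Equiv.Perm G}

/-- Since `f` fixes `1`, the out-neighbours of `1` show that the arc set of `S` is carried to the
arc set of `f '' S` itself. -/
theorem mem_iff_of_mem_isoOne (hf : f ∈ A.isoOne) {S : Set G} (hS : A.IsASet S) (g h : G) :
    h * g⁻¹ ∈ S ↔ f h * (f g)⁻¹ ∈ f '' S := by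
  obtain ⟨⟨B, hB⟩, h1⟩ := hf
  have hiff := hB.cell_eq_cell_iff
  constructor
  · intro hh
    refine ⟨f.symm (f h * (f g)⁻¹), ?_, by simp⟩
    refine hS.cell_subset hh ?_
    rw [mem_cell_iff_cell_eq]
    simpa [h1] using hiff 1 (f.symm (f h * (f g)⁻¹)) g h
  · rintro ⟨s, hs, e⟩
    refine hS.cell_subset hs ?_
    rw [mem_cell_iff_cell_eq]
    simpa [h1, e] using hiff g h 1 s

/-- `S * T` is the set of out-neighbours of `T` in the digraph of `S`; this is why `T` may be
arbitrary. -/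
theorem image_mul_of_mem_isoOne (hf : f ∈ A.isoOne) {S : Set G} (hS : A.IsASet S) (T : Set G) :
    f '' (S * T) = f '' S * f '' T := by
  have key := mem_iff_of_mem_isoOne hf hS
  ext y
  constructor
  · rintro ⟨_, ⟨s, hs, t, ht, rfl⟩, rfl⟩
    exact ⟨_, (key t (s * t)).1 (by simpa using hs), _, ⟨t, ht, rfl⟩, by simp⟩
  · rintro ⟨s, hs, _, ⟨t, ht, rfl⟩, rfl⟩
    refine ⟨f.symm (s * f t), ?_, by simp⟩
    exact ⟨_, (key t (f.symm (s * f t))).2 (by simpa using hs), t, ht, by simp⟩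

theorem image_mem_mul_of_mem_isoOne (hf : f ∈ A.isoOne) {S : Set G} (hS : A.IsASet S) {g h : G}
    (hh : h ∈ S * {g}) : f h ∈ f '' S * {f g} := by
  rw [← Set.image_singleton, ← image_mul_of_mem_isoOne hf hS]
  exact Set.mem_image_of_mem f hh

theorem mem_iff_of_mem_aut (hf : f ∈ A.aut) {S : Set G} (hS : A.IsASet S) (g h : G) :
    h * g⁻¹ ∈ S ↔ f h * (f g)⁻¹ ∈ S := by
  have hX : ∀ X ∈ A.basicSets, ∀ g h, h * g⁻¹ ∈ X ↔ f h * (f g)⁻¹ ∈ X := fun X hX g h => by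
    rw [← mk_mem_image_arcs f, hf X hX, mk_mem_arcs]
  constructor
  · intro hh
    exact hS.cell_subset hh ((hX _ (A.cell_mem_basicSets _) g h).1 (A.mem_cell_self _))
  · intro hh
    exact hS.cell_subset hh ((hX _ (A.cell_mem_basicSets _) g h).2 (A.mem_cell_self _))

theorem apply_mem_cell_of_mem_aut (hf : f ∈ A.aut) (h1 : f 1 = 1) (g : G) : f g ∈ A.cell g := by
  have := (mem_iff_of_mem_aut hf (A.isASet_cell g) 1 g).1 (by simpa using A.mem_cell_self g)
  simpa [h1] using this

/-- A group `K` with `A = V(K, G)` lies in `Aut(A)`, and its stabilizer of `1` already has the basic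
sets as orbits. -/
theorem exists_aut_of_mem_cell (hA : A.IsSchurian) {g h : G} (hh : h ∈ A.cell g) :
    ∃ k ∈ A.aut, k 1 = 1 ∧ k g = h := by
  obtain ⟨K, hK, rfl⟩ := hA
  have hcell : ∀ g, (transitivityModule K hK).cell g =
      MulAction.orbit (MulAction.stabilizer K (1 : G)) g := fun g =>
    cell_eq_of_mem (A := transitivityModule K hK) ⟨g, rfl⟩ (MulAction.mem_orbit_self g)
  rw [hcell] at hh
  obtain ⟨⟨⟨k, hkK⟩, hk⟩, rfl⟩ := hh
  refine ⟨k, ?_, hk, rfl⟩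
  -- Conjugating `k` by right translations gives an element of `K` that fixes `1` and takes `h *
  -- g⁻¹` to `k h * (k g)⁻¹`.
  have key : ∀ k ∈ K, ∀ g h : G, k h * (k g)⁻¹ ∈
      MulAction.orbit (MulAction.stabilizer K (1 : G)) (h * g⁻¹) := by
    intro k hk g h
    have hmem : Equiv.mulRight (k g)⁻¹ * k * Equiv.mulRight g ∈ K :=
      K.mul_mem (K.mul_mem (hK ⟨_, rfl⟩) hk) (hK ⟨_, rfl⟩)
    have hst : (⟨_, hmem⟩ : K) ∈ MulAction.stabilizer K (1 : G) := by
      change k (1 * g) * (k g)⁻¹ = 1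
      simp
    refine ⟨⟨⟨_, hmem⟩, hst⟩, ?_⟩
    change k (h * g⁻¹ * g) * (k g)⁻¹ = _
    simp
  have hsub : ∀ k ∈ K, ∀ X ∈ (transitivityModule K hK).basicSets,
      ∀ g h : G, h * g⁻¹ ∈ X → k h * (k g)⁻¹ ∈ X := by
    intro k hk X hX g h hgh
    rw [← cell_eq_of_mem hX hgh, hcell]
    exact key k hk g h
  intro X hX
  ext ⟨u, v⟩
  obtain ⟨g, rfl⟩ := k.surjective u
  obtain ⟨h, rfl⟩ := k.surjective v
  rw [mk_mem_image_arcs, mk_mem_arcs]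
  refine ⟨hsub k hkK X hX g h, fun hh => ?_⟩
  simpa using hsub k⁻¹ (K.inv_mem hkK) X hX _ _ hh

end Perm

/-! ### Schur's theorem on multipliers -/

section Multiplier

variable {G : Type*} [CommGroup G] [Finite G] {A : SRing G} {f : Equiv.Perm G}

/-- Frobenius in the group algebra over `ZMod l`; coprimality makes `x ↦ x ^ l` injective, so no
terms collide. -/
theorem coeff_groupSum_pow_prime {l : ℕ} [Fact l.Prime] (hl : (Nat.card G).Coprime l)
    (S : Set G) (g : G) :
    (((groupSum S ^ l).coeff g : ℤ) : ZMod l) =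
      (((groupSum ((· ^ l) '' S)).coeff g : ℤ) : ZMod l) := by
  classical
  have hinj : Function.Injective (fun x : G => x ^ l) := (Nat.Coprime.pow_left_bijective hl).1
  let φ := MonoidAlgebra.mapRingHom G (Int.castRingHom (ZMod l))
  have hcoeff : ∀ v : MonoidAlgebra ℤ G, ((v.coeff g : ℤ) : ZMod l) = (φ v).coeff g := fun v => by
    simp [φ, MonoidAlgebra.coeff_mapRingHom]
  have hφ : ∀ x : G, φ (MonoidAlgebra.of ℤ G x) = MonoidAlgebra.of (ZMod l) G x := fun x => by
    simp [φ]
  have : CharP (MonoidAlgebra (ZMod l) G) l :=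
    charP_of_injective_algebraMap (FaithfulSMul.algebraMap_injective (ZMod l) (MonoidAlgebra (ZMod l) G)) l
  have himg : ((· ^ l) '' S).toFinite.toFinset = S.toFinite.toFinset.image (· ^ l) := by
    ext; simp
  rw [hcoeff, hcoeff, map_pow]
  congr 2
  rw [groupSum, groupSum, himg, Finset.sum_image (fun x _ y _ h => hinj h), map_sum, map_sum,
    sum_pow_char]
  refine Finset.sum_congr rfl fun x _ => ?_
  rw [hφ, hφ, map_pow]

/-- The coefficient counts walks of length `n` from `1` to `g` in the digraph of `S`, and `f`
carries walks to walks. -/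
theorem coeff_groupSum_pow_image (hf : f ∈ A.isoOne) {S : Set G} (hS : A.IsASet S) (n : ℕ) (g : G) :
    (groupSum (f '' S) ^ n).coeff (f g) = (groupSum S ^ n).coeff g := by
  classical
  have := Fintype.ofFinite G
  induction n generalizing g with
  | zero =>
    have : (1 = f g) ↔ (1 = g) := by
      rw [← hf.2, f.injective.eq_iff, hf.2]
    simp [MonoidAlgebra.one_def, Finsupp.single_apply, this]
  | succ n ih =>
    rw [pow_succ', pow_succ', MonoidAlgebra.coeff_mul_apply_right,
      MonoidAlgebra.coeff_mul_apply_right, Finsupp.sum_fintype _ _ (by simp),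
      Finsupp.sum_fintype _ _ (by simp)]
    refine (Fintype.sum_equiv f _ _ fun z => ?_).symm
    rw [ih, coeff_groupSum, coeff_groupSum]
    simp only [mem_iff_of_mem_isoOne hf hS z g]

theorem isASet_image_pow_prime {l : ℕ} [Fact l.Prime] (hl : (Nat.card G).Coprime l)
    {S : Set G} (hS : A.IsASet S) : A.IsASet ((· ^ l) '' S) := by
  classical
  refine isASet_iff_coeff.2 fun X hX g hg g' hg' => ?_
  have h : groupSum S ^ l ∈ A.toSubring := pow_mem hS l
  rw [A.mem_iff_mem_span, mem_span_groupSum_iff A.isPartition] at h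
  have h2 : (((groupSum ((· ^ l) '' S)).coeff g : ℤ) : ZMod l) =
      (((groupSum ((· ^ l) '' S)).coeff g' : ℤ) : ZMod l) := by
    rw [← coeff_groupSum_pow_prime hl, ← coeff_groupSum_pow_prime hl, h X hX g hg g' hg']
  -- Both coefficients are `0` or `1`, so congruence modulo `l` forces equality.
  rw [coeff_groupSum, coeff_groupSum] at h2 ⊢
  split_ifs at h2 ⊢ <;> simp_all

theorem image_image_pow_prime {l : ℕ} [Fact l.Prime] (hl : (Nat.card G).Coprime l)
    (hf : f ∈ A.isoOne) {S : Set G} (hS : A.IsASet S) :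
    f '' ((· ^ l) '' S) = (· ^ l) '' (f '' S) := by
  classical
  ext y
  obtain ⟨g, rfl⟩ := f.surjective y
  rw [f.injective.mem_set_image]
  have h2 : (((groupSum ((· ^ l) '' S)).coeff g : ℤ) : ZMod l) =
      (((groupSum ((· ^ l) '' (f '' S))).coeff (f g) : ℤ) : ZMod l) := by
    rw [← coeff_groupSum_pow_prime hl, ← coeff_groupSum_pow_prime hl, coeff_groupSum_pow_image hf hS]
  rw [coeff_groupSum, coeff_groupSum] at h2
  by_cases h3 : g ∈ (· ^ l) '' S <;> by_cases h4 : f g ∈ (· ^ l) '' (f '' S) <;>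
    simp only [h3, h4, if_true, if_false, Int.cast_one, Int.cast_zero, one_ne_zero,
      zero_ne_one] at h2 ⊢

/-- Schur's theorem on multipliers: the `m`-th powers of the elements of an `A`-set, `m` coprime to
the order of the group, form an `A`-set, and normalized isomorphisms commute with this operation. -/
theorem image_pow_of_coprime (hf : f ∈ A.isoOne) {m : ℕ} (hm : (Nat.card G).Coprime m)
    {S : Set G} (hS : A.IsASet S) :
    A.IsASet ((· ^ m) '' S) ∧ f '' ((· ^ m) '' S) = (· ^ m) '' (f '' S) := by
  induction m using induction_on_primes generalizing S with
  | zero =>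
    have : Subsingleton G := by
      rw [Nat.coprime_zero_right, Nat.card_eq_one_iff_unique] at hm
      exact hm.1
    have e : (fun x : G => x ^ 0) = id := by
      funext x
      exact Subsingleton.elim _ _
    simp only [e, Set.image_id]
    exact ⟨hS, trivial⟩
  | one => simpa using hS
  | prime_mul l m hl ih =>
    have := Fact.mk hl
    obtain ⟨h1, h2⟩ := ih hm.coprime_mul_left_right hS
    have hl' := hm.coprime_mul_right_right
    have e : (fun x : G => x ^ (l * m)) = (fun x => x ^ l) ∘ (fun x => x ^ m) := by
      funext x
      simp [← pow_mul, mul_comm]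
    simp only [e, Set.image_comp]
    exact ⟨isASet_image_pow_prime hl' h1, by rw [image_image_pow_prime hl' hf h1, h2]⟩

theorem one_mem_isoOne (A : SRing G) : (1 : Equiv.Perm G) ∈ A.isoOne :=
  ⟨⟨A, by simp [IsIso]⟩, rfl⟩

theorem isASet_image_pow {m : ℕ} (hm : (Nat.card G).Coprime m) {S : Set G} (hS : A.IsASet S) :
    A.IsASet ((· ^ m) '' S) :=
  (image_pow_of_coprime A.one_mem_isoOne hm hS).1

theorem pow_mem_cell_pow {m : ℕ} (hm : (Nat.card G).Coprime m) {g h : G} (hh : h ∈ A.cell g) :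
    h ^ m ∈ A.cell (g ^ m) := by
  have hsub : A.cell (h ^ m) ⊆ (· ^ m) '' A.cell g :=
    (isASet_image_pow hm (A.isASet_cell g)).cell_subset ⟨h, hh, rfl⟩
  have hsub' : A.cell (g ^ m) ⊆ (· ^ m) '' A.cell g :=
    (isASet_image_pow hm (A.isASet_cell g)).cell_subset ⟨g, A.mem_cell_self g, rfl⟩
  have hcard : ∀ x : G, (A.cell x).ncard ≤ (A.cell (x ^ m)).ncard := by
    intro x
    -- An inverse of `m` modulo the group order undoes the power map, so basic sets cannot shrink
    -- under it.
    obtain ⟨n, hn⟩ : ∃ n : ℕ, (Nat.card G).Coprime n ∧ ∀ x : G, (x ^ m) ^ n = x := by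
      obtain ⟨n, hn, hn'⟩ : ∃ n : ℕ, (Nat.card G).Coprime n ∧ m * n ≡ 1 [MOD Nat.card G] := by
        have : NeZero (Nat.card G) := ⟨Nat.card_pos.ne'⟩
        refine ⟨((ZMod.unitOfCoprime m hm.symm)⁻¹ : (ZMod (Nat.card G))ˣ).1.val,
          (ZMod.val_coe_unit_coprime _).symm, ?_⟩
        rw [← ZMod.natCast_eq_natCast_iff]
        push_cast
        rw [ZMod.natCast_val, ZMod.cast_id, ← ZMod.coe_unitOfCoprime m hm.symm, ← Units.val_mul,
          mul_inv_cancel, Units.val_one]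
      refine ⟨n, hn, fun x => ?_⟩
      rw [← pow_mul]
      conv_rhs => rw [← pow_one x]
      exact pow_eq_pow_iff_modEq.2 (hn'.of_dvd (orderOf_dvd_natCard x))
    have hs : A.cell x ⊆ (· ^ n) '' A.cell (x ^ m) :=
      (isASet_image_pow hn.1 (A.isASet_cell (x ^ m))).cell_subset
        ⟨x ^ m, A.mem_cell_self _, hn.2 x⟩
    exact le_trans (Set.ncard_le_ncard hs) Set.ncard_image_le
  have hle : ((· ^ m) '' A.cell g).ncard ≤ (A.cell (g ^ m)).ncard :=
    le_trans Set.ncard_image_le (hcard g)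
  have e : A.cell (g ^ m) = (· ^ m) '' A.cell g :=
    Set.eq_of_subset_of_ncard_le hsub' hle
  rw [e]
  exact ⟨h, hh, rfl⟩

theorem image_pow_cell {m : ℕ} (hm : (Nat.card G).Coprime m) (g : G) :
    (· ^ m) '' A.cell g = A.cell (g ^ m) := by
  apply Set.Subset.antisymm
  · rintro _ ⟨h, hh, rfl⟩
    exact pow_mem_cell_pow hm hh
  · exact (isASet_image_pow hm (A.isASet_cell g)).cell_subset ⟨g, A.mem_cell_self g, rfl⟩

theorem image_cell_pow (hf : f ∈ A.isoOne) {m : ℕ} (hm : (Nat.card G).Coprime m) {g : G}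
    (hg : f '' A.cell g = A.cell g) : f '' A.cell (g ^ m) = A.cell (g ^ m) := by
  rw [← image_pow_cell hm, (image_pow_of_coprime hf hm (A.isASet_cell g)).2, hg]

end Multiplier

end SRing

/-! ### Finite differences over a prime field and affine maps -/

section PrimeDegree

open Polynomial

variable {F : Type*} [Field F]

/-- The difference operator `P ↦ ∑ s ∈ S, (P(X + s) - P(X))`. -/
noncomputable def sumDiff (S : Finset F) (P : F[X]) : F[X] :=
  ∑ s ∈ S, (taylor s P - P)

theorem eval_sumDiff (S : Finset F) (P : F[X]) (x : F) :
    (sumDiff S P).eval x = ∑ s ∈ S, (P.eval (x + s) - P.eval x) := by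
  simp [sumDiff, eval_finsetSum, taylor_eval]

/-- In the Taylor expansion of `P(X + s)` the terms in `s ^ m` with `0 < m < k` cancel after
summation over `S`; the degree bound on `P` leaves only `m = k`. -/
theorem coeff_sumDiff {S : Finset F} {k : ℕ} (hk : 0 < k)
    (hS : ∀ j, 0 < j → j < k → ∑ s ∈ S, s ^ j = 0) {P : F[X]} {i : ℕ}
    (hP : P.natDegree ≤ i + k) :
    (sumDiff S P).coeff i = ((i + k).choose i : F) * P.coeff (i + k) * ∑ s ∈ S, s ^ k := by
  have ht : ∀ s, (taylor s P).coeff i =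
      ∑ m ∈ Finset.range (k + 1), ((m + i).choose i : F) * P.coeff (m + i) * s ^ m := by
    intro s
    have hdeg : (hasseDeriv i P).natDegree < k + 1 := by
      have := natDegree_hasseDeriv_le P i
      omega
    rw [taylor_coeff, eval_eq_sum_range' hdeg]
    simp only [hasseDeriv_coeff]
  have hsum : (sumDiff S P).coeff i = ∑ m ∈ Finset.range (k + 1),
      ((m + i).choose i : F) * P.coeff (m + i) * ∑ s ∈ S, (s ^ m - if m = 0 then 1 else 0) := by
    have : ∀ s, (taylor s P - P).coeff i = ∑ m ∈ Finset.range (k + 1),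
        ((m + i).choose i : F) * P.coeff (m + i) * (s ^ m - if m = 0 then 1 else 0) := by
      intro s
      simp only [mul_sub, Finset.sum_sub_distrib, coeff_sub, ht]
      simp
    rw [sumDiff, finsetSum_coeff]
    simp only [this, Finset.mul_sum]
    rw [Finset.sum_comm]
  rw [hsum, Finset.sum_range_succ, Finset.sum_eq_zero, zero_add]
  · simp only [hk.ne', if_false, sub_zero, add_comm k i]
  · intro m hm
    rcases Nat.eq_zero_or_pos m with rfl | hm0
    · simp
    · simp only [hm0.ne', if_false, sub_zero]
      rw [hS m hm0 (Finset.mem_range.1 hm), mul_zero]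

theorem natDegree_sumDiff_le {S : Finset F} {k : ℕ} (hk : 0 < k)
    (hS : ∀ j, 0 < j → j < k → ∑ s ∈ S, s ^ j = 0) (P : F[X]) :
    (sumDiff S P).natDegree ≤ P.natDegree - k := by
  refine natDegree_le_iff_coeff_eq_zero.2 fun i hi => ?_
  rw [coeff_sumDiff hk hS (by omega), coeff_eq_zero_of_natDegree_lt (p := P) (by omega)]
  simp

theorem sumDiff_eq_zero {S : Finset F} {k : ℕ}
    (hS : ∀ j, 0 < j → j < k → ∑ s ∈ S, s ^ j = 0) {P : F[X]} (hP : P.natDegree < k) :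
    sumDiff S P = 0 := by
  ext i
  rw [coeff_sumDiff (by omega) hS (by omega), coeff_eq_zero_of_natDegree_lt (p := P) (by omega)]
  simp

variable {q : ℕ} [Fact q.Prime]

/-- Degree below `q` keeps the binomial coefficient nonzero modulo `q`, so the degree drops by
exactly `k`. -/
theorem coeff_sumDiff_ne_zero {S : Finset (ZMod q)} {k : ℕ} (hk : 0 < k)
    (hS : ∀ j, 0 < j → j < k → ∑ s ∈ S, s ^ j = 0) (hSk : ∑ s ∈ S, s ^ k ≠ 0) {P : (ZMod q)[X]}
    (hP : k ≤ P.natDegree) (hPq : P.natDegree < q) :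
    (sumDiff S P).coeff (P.natDegree - k) ≠ 0 := by
  have e : P.natDegree - k + k = P.natDegree := by omega
  rw [coeff_sumDiff hk hS (by omega), e]
  refine mul_ne_zero (mul_ne_zero ?_ ?_) hSk
  · rw [Ne, ZMod.natCast_eq_zero_iff]
    intro hdvd
    have h2 : q ∣ (P.natDegree).factorial := by
      rw [← Nat.choose_mul_factorial_mul_factorial (Nat.sub_le P.natDegree k), mul_assoc]
      exact hdvd.mul_right _
    rw [(Fact.out : q.Prime).dvd_factorial] at h2
    omega
  · have : P ≠ 0 := by
      rintro rfl
      simp only [natDegree_zero] at hP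
      omega
    exact leadingCoeff_ne_zero.2 this

theorem natDegree_sumDiff {S : Finset (ZMod q)} {k : ℕ} (hk : 0 < k)
    (hS : ∀ j, 0 < j → j < k → ∑ s ∈ S, s ^ j = 0) (hSk : ∑ s ∈ S, s ^ k ≠ 0) {P : (ZMod q)[X]}
    (hP : k ≤ P.natDegree) (hPq : P.natDegree < q) :
    (sumDiff S P).natDegree = P.natDegree - k :=
  le_antisymm (natDegree_sumDiff_le hk hS P)
    (le_natDegree_of_ne_zero (coeff_sumDiff_ne_zero hk hS hSk hP hPq))

theorem exists_polynomial_eval_eq (g : ZMod q → ZMod q) :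
    ∃ P : (ZMod q)[X], P.natDegree < q ∧ ∀ x, P.eval x = g x := by
  classical
  have hinj : Set.InjOn (id : ZMod q → ZMod q) (Finset.univ : Finset (ZMod q)) :=
    Function.injective_id.injOn
  refine ⟨Lagrange.interpolate Finset.univ id g, ?_, fun x => ?_⟩
  · have h := Lagrange.degree_interpolate_lt g hinj
    rw [Finset.card_univ, ZMod.card] at h
    by_cases h0 : Lagrange.interpolate Finset.univ id g = 0
    · rw [h0, natDegree_zero]
      exact (Fact.out : q.Prime).pos
    · exact (natDegree_lt_iff_degree_lt h0).2 h
  · exact Lagrange.eval_interpolate_at_node g hinj (Finset.mem_univ x)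

theorem eq_of_eval_eq_of_natDegree_lt {P Q : (ZMod q)[X]} (hP : P.natDegree < q)
    (hQ : Q.natDegree < q) (h : ∀ x, P.eval x = Q.eval x) : P = Q :=
  eq_of_natDegree_lt_card_of_eval_eq P Q Function.injective_id h
    (by rw [ZMod.card]; exact max_lt hP hQ)

/-- By Fermat the power sum of exponent `q - 1` equals `|S|`, which is nonzero modulo `q`; hence a
least `k` exists. The bound `k + 1 < q` is what uses that `S` misses a nonzero element. -/
theorem exists_least_power_sum_ne_zero {S : Finset (ZMod q)} (h0 : 0 ∉ S) (hne : S.Nonempty)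
    (hproper : ∃ y, y ≠ 0 ∧ y ∉ S) :
    ∃ k, 0 < k ∧ k + 1 < q ∧ (∀ j, 0 < j → j < k → ∑ s ∈ S, s ^ j = 0) ∧ ∑ s ∈ S, s ^ k ≠ 0 := by
  classical
  have hq := (Fact.out : q.Prime).two_le
  obtain ⟨y, hy0, hyS⟩ := hproper
  have hcard : S.card < q := by
    have : S ⊂ Finset.univ := Finset.ssubset_univ_iff.2 fun h => h0 (h ▸ Finset.mem_univ 0)
    simpa [ZMod.card] using Finset.card_lt_card this
  have hq1 : ∑ s ∈ S, s ^ (q - 1) ≠ 0 := by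
    rw [Finset.sum_congr rfl fun s hs => ZMod.pow_card_sub_one_eq_one fun h => h0 (h ▸ hs)]
    rw [Finset.sum_const, nsmul_eq_mul, mul_one, Ne, ZMod.natCast_eq_zero_iff]
    exact Nat.not_dvd_of_pos_of_lt hne.card_pos hcard
  have hex : ∃ k, 0 < k ∧ ∑ s ∈ S, s ^ k ≠ 0 := ⟨q - 1, by omega, hq1⟩
  obtain ⟨hk0, hk⟩ := Nat.find_spec hex
  have hmin : ∀ j, 0 < j → j < Nat.find hex → ∑ s ∈ S, s ^ j = 0 := fun j hj hlt => by
    by_contra hc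
    exact Nat.find_min hex hlt ⟨hj, hc⟩
  refine ⟨Nat.find hex, hk0, ?_, hmin, hk⟩
  by_contra hlt
  -- If `k ≥ q - 1`, the difference operator makes every reduced polynomial constant. Applied to the
  -- indicator function of `0`, this says that membership of `-x` in `S` is the same for all `x ≠
  -- 0`.
  obtain ⟨P, hPdeg, hP⟩ := exists_polynomial_eval_eq (q := q) (fun x => if x = 0 then 1 else 0)
  have hconst : (sumDiff S P).natDegree ≤ 0 := by
    have := natDegree_sumDiff_le hk0 hmin P
    omega
  rw [Nat.le_zero, natDegree_eq_zero] at hconst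
  obtain ⟨c, hc⟩ := hconst
  have heval : ∀ x, x ≠ 0 → (if -x ∈ S then (1 : ZMod q) else 0) = c := by
    intro x hx
    have h1 := eval_sumDiff S P x
    rw [← hc, eval_C] at h1
    rw [h1]
    simp only [hP, hx, if_false, sub_zero, ← neg_eq_iff_add_eq_zero, Finset.sum_ite_eq]
  obtain ⟨s, hs⟩ := hne
  have h1 := heval (-s) (neg_ne_zero.2 fun h => h0 (h ▸ hs))
  have h2 := heval (-y) (neg_ne_zero.2 hy0)
  simp only [neg_neg, hs, hyS, if_true, if_false] at h1 h2
  exact one_ne_zero (h1.trans h2.symm)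

/-- A map on a field of prime order that preserves the difference graph of a proper nonempty set of
nonzero elements is affine. -/
theorem exists_affine_of_image_sub_eq [DecidableEq (ZMod q)] {S : Finset (ZMod q)} (h0 : 0 ∉ S)
    (hne : S.Nonempty) (hproper : ∃ y, y ≠ 0 ∧ y ∉ S) {π : ZMod q → ZMod q}
    (hinj : Function.Injective π) (hπ : ∀ x, S.image (fun s => π (x + s) - π x) = S) :
    ∃ α β, ∀ x, π x = α * x + β := by
  obtain ⟨k, hk0, hkq, hmin, hk⟩ := exists_least_power_sum_ne_zero h0 hne hproper
  obtain ⟨P, hPq, hP⟩ := exists_polynomial_eval_eq π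
  -- As `π` permutes the differences in `S`, the difference operator commutes with composition with
  -- `π`.
  have hcomm : ∀ Q R : (ZMod q)[X], (∀ x, R.eval x = Q.eval (π x)) →
      ∀ x, (sumDiff S R).eval x = (sumDiff S Q).eval (π x) := by
    intro Q R hR x
    have hsum : ∑ s ∈ S, (Q.eval (π x + s) - Q.eval (π x)) =
        ∑ s ∈ S.image (fun s => π (x + s) - π x), (Q.eval (π x + s) - Q.eval (π x)) := by
      rw [hπ x]
    rw [eval_sumDiff, eval_sumDiff, hsum, Finset.sum_image]
    · simp [hR]
    · intro s _ t _ hst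
      simpa using hinj (sub_left_injective hst)
  -- The difference of `X ^ (k + 1)` is linear, so an affine image of `P` is itself the difference
  -- of a reduced polynomial and has lost `k` degrees.
  have hlin : P.natDegree ≤ q - 1 - k := by
    obtain ⟨R, hRq, hR⟩ := exists_polynomial_eval_eq (fun x => π x ^ (k + 1))
    have h1 := hcomm (X ^ (k + 1)) R (by simpa using hR)
    have hdeg := natDegree_sumDiff hk0 hmin hk (P := X ^ (k + 1)) (by simp) (by simpa using hkq)
    rw [natDegree_X_pow, Nat.add_sub_cancel_left] at hdeg
    obtain ⟨α, hα, β, hαβ⟩ := natDegree_eq_one.1 hdeg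
    have h2 : C α * P + C β = sumDiff S R := by
      refine eq_of_eval_eq_of_natDegree_lt ?_ ?_ fun x => ?_
      · rwa [natDegree_add_C, natDegree_C_mul hα]
      · have := natDegree_sumDiff_le hk0 hmin R
        omega
      · rw [h1, ← hαβ]
        simp [hP]
    have h3 : (C α * P + C β).natDegree = P.natDegree := by
      rw [natDegree_add_C, natDegree_C_mul hα]
    have := natDegree_sumDiff_le hk0 hmin R
    rw [← h2, h3] at this
    omega
  have hle : P.natDegree ≤ 1 := by
    by_cases hkn : k * P.natDegree < q
    · have h1 := hcomm (X ^ k) (P ^ k) (by simp [hP])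
      have hdeg := natDegree_sumDiff hk0 hmin hk (P := X ^ k) (by simp) (by simp; omega)
      rw [natDegree_X_pow, Nat.sub_self, natDegree_eq_zero] at hdeg
      obtain ⟨c, hc⟩ := hdeg
      rcases Nat.eq_zero_or_pos P.natDegree with hn | hn
      · omega
      have hkle : k ≤ k * P.natDegree := Nat.le_mul_of_pos_right k hn
      have hdeg2 := natDegree_sumDiff hk0 hmin hk (P := P ^ k) (by rwa [natDegree_pow])
        (by rwa [natDegree_pow])
      rw [natDegree_pow] at hdeg2
      have h2 : C c = sumDiff S (P ^ k) := by
        refine eq_of_eval_eq_of_natDegree_lt ?_ ?_ fun x => ?_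
        · rw [natDegree_C]; omega
        · omega
        · rw [h1, ← hc, eval_C, eval_C]
      rw [← h2, natDegree_C] at hdeg2
      by_contra hlt
      have : k * 2 ≤ k * P.natDegree := Nat.mul_le_mul_left k (by omega)
      omega
    · rcases Nat.eq_zero_or_pos P.natDegree with hn | hn
      · omega
      exfalso
      -- With `m = (q - 1) / n` one has `m < k`, so the difference of `X ^ m` vanishes. But `P ^ m`
      -- has degree `m * n`, which exceeds `q - 1 - n ≥ k` and is below `q`, so its difference is
      -- nonzero.
      obtain ⟨n, hndef⟩ : ∃ n, n = P.natDegree := ⟨_, rfl⟩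
      rw [← hndef] at hlin hkn hn
      have hm1 : (q - 1) / n * n ≤ q - 1 := Nat.div_mul_le_self _ _
      have hm2 : q - 1 < (q - 1) / n * n + n := Nat.lt_div_mul_add hn
      have hmk : (q - 1) / n < k := by
        rw [Nat.div_lt_iff_lt_mul hn]
        omega
      obtain ⟨m, hm⟩ : ∃ m, m = (q - 1) / n := ⟨_, rfl⟩
      rw [← hm] at hm1 hm2 hmk
      have hdeg : (P ^ m).natDegree = m * n := by rw [natDegree_pow, hndef]
      have h1 := hcomm (X ^ m) (P ^ m) (by simp [hP])
      rw [sumDiff_eq_zero hmin (P := X ^ m) (by simpa using hmk)] at h1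
      have hz : sumDiff S (P ^ m) = 0 := by
        refine eq_of_eval_eq_of_natDegree_lt ?_ ?_ fun x => ?_
        · have := natDegree_sumDiff_le hk0 hmin (P ^ m)
          omega
        · rw [natDegree_zero]; omega
        · rw [h1, eval_zero, eval_zero]
      exact coeff_sumDiff_ne_zero hk0 hmin hk (P := P ^ m) (by omega) (by omega)
        (by rw [hz, coeff_zero])
  obtain ⟨α, β, h⟩ := exists_eq_X_add_C_of_natDegree_le_one hle
  refine ⟨α, β, fun x => ?_⟩
  rw [← hP, h]
  simp

end PrimeDegree

namespace SRing

/-! ### Basic sets of the iterated wreath product -/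

section Wreath

variable {G G' : Type*} [Group G] [Finite G] [Group G'] [Finite G']

theorem cell_full (g : G) : (full G).cell g = {g} :=
  cell_eq_of_mem (A := full G) ⟨g, rfl⟩ rfl

theorem mem_cell_wreath {A : SRing G} {B : SRing G'} {x y : G × G'} :
    y ∈ (A.wreath B).cell x ↔ y.2 ∈ B.cell x.2 ∧ (x.2 = 1 → y.1 ∈ A.cell x.1) := by
  obtain ⟨g, h⟩ := x
  obtain ⟨g', h'⟩ := y
  by_cases hh : h = 1
  · subst hh
    have hB : B.cell 1 = {1} := cell_eq_of_mem B.singleton_one_mem rfl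
    have e : (A.wreath B).cell (g, 1) = A.cell g ×ˢ ({1} : Set G') :=
      cell_eq_of_mem (A := A.wreath B) (Or.inl ⟨_, A.cell_mem_basicSets g, rfl⟩)
        ⟨A.mem_cell_self g, rfl⟩
    rw [e, hB]
    simp [and_comm]
  · have hne : B.cell h ≠ {1} := by
      intro e
      have := B.mem_cell_self h
      rw [e] at this
      exact hh this
    have e : (A.wreath B).cell (g, h) = (Set.univ : Set G) ×ˢ B.cell h :=
      cell_eq_of_mem (A := A.wreath B) (Or.inr ⟨_, B.cell_mem_basicSets h, hne, rfl⟩)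
        ⟨trivial, B.mem_cell_self h⟩
    rw [e]
    simp [hh]

end Wreath

section Levels

variable {G G' : Type*} [Group G] [Finite G] [Group G'] [Finite G'] {A : SRing G} {B : SRing G'}

/-- If in `B` the basic sets of size at most `n` cover exactly `N` points, the others have size at
least `N` and are unions of translates by those points, then in any isomorphic S-ring `A` every
`A`-subgroup of order `N` consists of the basic sets of size at most `n`, and the basic sets outside
are unions of its cosets. -/
theorem Isomorphic.mem_subgroup_iff (hAB : Isomorphic A B) {n N : ℕ}
    (hcard : {w | (B.cell w).ncard ≤ n}.ncard = N)
    (hgap : ∀ w, n < (B.cell w).ncard → N ≤ (B.cell w).ncard)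
    (hmul : ∀ t w, (B.cell t).ncard ≤ n → n < (B.cell w).ncard → B.cell (t * w) = B.cell w)
    {U : Subgroup G} (hU : A.IsASubgroup U) (hUN : Nat.card U = N) :
    (∀ x, x ∈ U ↔ (A.cell x).ncard ≤ n) ∧ ∀ x ∉ U, ∀ y ∈ U, y * x ∈ A.cell x := by
  obtain ⟨f, hf⟩ := hAB
  have hsize : ∀ x, (A.cell x).ncard = (B.cell (f x * (f 1)⁻¹)).ncard := fun x => by
    simpa using hf.ncard_cell 1 x
  have hcardA : {x | (A.cell x).ncard ≤ n}.ncard = N := by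
    rw [← hcard]
    refine Set.ncard_congr (fun x _ => f x * (f 1)⁻¹) ?_ ?_ ?_
    · intro x hx
      simpa [← hsize] using hx
    · intro x y _ _ e
      simpa using e
    · intro w hw
      refine ⟨f.symm (w * f 1), ?_, by simp⟩
      simpa [hsize] using hw
  -- A basic set of size above `n` inside `U` would have at least `N = |U|` points and yet miss `1`.
  have hsub : (U : Set G) ⊆ {x | (A.cell x).ncard ≤ n} := by
    intro x hx
    by_contra hn
    have h1 : N ≤ (A.cell x).ncard := by
      rw [hsize]
      apply hgap
      rw [← hsize]
      simpa using hn
    have h2 : A.cell x ⊂ (U : Set G) := by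
      refine ⟨IsASet.cell_subset hU hx, fun h => ?_⟩
      have h3 : A.cell x = {1} :=
        (cell_eq_cell (h U.one_mem)).symm.trans (cell_eq_of_mem A.singleton_one_mem rfl)
      have h4 : x = 1 := by
        have := A.mem_cell_self x
        rwa [h3] at this
      subst h4
      -- If `n` were `0`, no basic set would be small and `N` would be `0`.
      have h5 : ({1} : Set G).ncard ≤ n := by
        have hcell1 : (B.cell (f 1 * (f 1)⁻¹)).ncard = 1 := by
          rw [mul_inv_cancel, cell_eq_of_mem B.singleton_one_mem rfl, Set.ncard_singleton]
        by_contra hlt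
        have : ∀ w, n < (B.cell w).ncard := by
          intro w
          have := (Set.ncard_pos (s := B.cell w)).2 ⟨w, B.mem_cell_self w⟩
          rw [Set.ncard_singleton] at hlt
          omega
        have hN : N = 0 := by
          rw [← hcard, Set.ncard_eq_zero]
          ext w
          simpa using this w
        rw [hN] at hUN
        exact Nat.card_pos.ne' hUN
      rw [← h3] at h5
      exact hn h5
    have h6 := Set.ncard_lt_ncard h2
    rw [← Nat.card_coe_set_eq (U : Set G)] at h6
    change _ < Nat.card U at h6
    omega
  have heq : (U : Set G) = {x | (A.cell x).ncard ≤ n} := by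
    refine Set.eq_of_subset_of_ncard_le hsub ?_
    rw [hcardA, ← Nat.card_coe_set_eq (U : Set G)]
    exact hUN.ge
  have hmem : ∀ x, x ∈ U ↔ (A.cell x).ncard ≤ n := fun x => Set.ext_iff.1 heq x
  refine ⟨hmem, fun x hx y hy => ?_⟩
  have hy' : (A.cell (y * x * x⁻¹)).ncard ≤ n := by
    rwa [mul_inv_cancel_right, ← hmem]
  rw [hf.ncard_cell] at hy'
  -- The arc from `x` to `y * x` has small type, and `f` preserves sizes of types; so in `B` the two
  -- images differ by an element of a small basic set, which `hmul` absorbs.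
  rw [hmem, hsize, not_le] at hx
  have h := hmul _ _ hy' hx
  rw [show f (y * x) * (f x)⁻¹ * (f x * (f 1)⁻¹) = f (y * x) * (f 1)⁻¹ by group] at h
  have h2 := (hf.cell_eq_cell_iff 1 (y * x) 1 x).2 h
  simp only [inv_one, mul_one] at h2
  exact mem_cell_iff_cell_eq.2 h2

end Levels

section IteratedWreath

theorem natCard_cyc {n : ℕ} : Nat.card (Cyc n) = n := by
  rw [Nat.card_congr Multiplicative.toAdd, Nat.card_zmod]

variable (p : ℕ) [Fact p.Prime]

/-- The S-ring `ℤC_p ≀ ℤC_p ≀ ℤC_p`. -/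
noncomputable abbrev cubeWreath : SRing ((Cyc p × Cyc p) × Cyc p) :=
  ((full (Cyc p)).wreath (full (Cyc p))).wreath (full (Cyc p))

variable {p}

theorem mem_cell_cubeWreath {x y : (Cyc p × Cyc p) × Cyc p} :
    y ∈ (cubeWreath p).cell x ↔
      y.2 = x.2 ∧ (x.2 = 1 → y.1.2 = x.1.2 ∧ (x.1.2 = 1 → y.1.1 = x.1.1)) := by
  simp only [mem_cell_wreath, cell_full, Set.mem_singleton_iff]

theorem ncard_cell_cubeWreath (x : (Cyc p × Cyc p) × Cyc p) :
    ((cubeWreath p).cell x).ncard = if x.2 = 1 then if x.1.2 = 1 then 1 else p else p ^ 2 := by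
  obtain ⟨⟨u, v⟩, w⟩ := x
  have huniv : (Set.univ : Set (Cyc p)).ncard = p := by rw [Set.ncard_univ, natCard_cyc]
  split_ifs with h1 h2
  · rw [Set.ncard_eq_one]
    refine ⟨((u, v), w), ?_⟩
    ext ⟨⟨u', v'⟩, w'⟩
    rw [mem_cell_cubeWreath]
    simp only at h1 h2
    simp [h1, h2]
    tauto
  · have : (cubeWreath p).cell ((u, v), w) = ((Set.univ : Set (Cyc p)) ×ˢ {v}) ×ˢ {w} := by
      ext ⟨⟨u', v'⟩, w'⟩
      rw [mem_cell_cubeWreath]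
      simp only at h1 h2
      simp [h1, h2]
      tauto
    rw [this, Set.ncard_prod, Set.ncard_prod, huniv, Set.ncard_singleton, Set.ncard_singleton]
    ring
  · have : (cubeWreath p).cell ((u, v), w) = ((Set.univ : Set (Cyc p)) ×ˢ Set.univ) ×ˢ {w} := by
      ext ⟨⟨u', v'⟩, w'⟩
      rw [mem_cell_cubeWreath]
      simp only at h1
      simp [h1]
    rw [this, Set.ncard_prod, Set.ncard_prod, huniv, Set.ncard_singleton]
    ring

variable {G : Type*} [Group G] [Finite G] {A : SRing G}

/-- The basic sets of the wreath product have sizes `1`, `p`, `p ^ 2`; the thresholds `1` and `p`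
single out `L` and `M`. Outside, a basic set contains a coset and is no larger than it. -/
theorem cells_of_isomorphic_cubeWreath (hA : Isomorphic A (cubeWreath p)) {L M : Subgroup G}
    (hL : A.IsASubgroup L) (hM : A.IsASubgroup M) (hLp : Nat.card L = p) (hMp : Nat.card M = p ^ 2) :
    (∀ x ∈ L, A.cell x = {x}) ∧ (∀ x ∈ M, x ∉ L → A.cell x = (L : Set G) * {x}) ∧
      ∀ x ∉ M, A.cell x = (M : Set G) * {x} := by
  have hp2 := (Fact.out : p.Prime).two_le
  have hpp : p < p ^ 2 := by nlinarith
  have huniv : (Set.univ : Set (Cyc p)).ncard = p := by rw [Set.ncard_univ, natCard_cyc]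
  obtain ⟨hL1, hL2⟩ := hA.mem_subgroup_iff (n := 1) (N := p) (by
      have : {w | ((cubeWreath p).cell w).ncard ≤ 1} =
          ((Set.univ : Set (Cyc p)) ×ˢ {1}) ×ˢ {1} := by
        ext ⟨⟨u, v⟩, w⟩
        rw [Set.mem_ofPred_eq, ncard_cell_cubeWreath]
        by_cases h1 : w = 1 <;> by_cases h2 : v = 1 <;> simp [h1, h2] <;> omega
      rw [this]
      simp [Set.ncard_prod, huniv])
    (by
      rintro ⟨⟨u, v⟩, w⟩
      rw [ncard_cell_cubeWreath]
      split_ifs <;> omega)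
    (by
      rintro ⟨⟨u, v⟩, w⟩ ⟨⟨u', v'⟩, w'⟩ h1 h2
      rw [ncard_cell_cubeWreath] at h1 h2
      rw [← mem_cell_iff_cell_eq, mem_cell_cubeWreath]
      simp only at h1 h2 ⊢
      split_ifs at h1 h2 <;> first | omega | simp_all)
    hL hLp
  obtain ⟨hM1, hM2⟩ := hA.mem_subgroup_iff (n := p) (N := p ^ 2) (by
      have : {w | ((cubeWreath p).cell w).ncard ≤ p} =
          ((Set.univ : Set (Cyc p)) ×ˢ Set.univ) ×ˢ {1} := by
        ext ⟨⟨u, v⟩, w⟩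
        rw [Set.mem_ofPred_eq, ncard_cell_cubeWreath]
        by_cases h1 : w = 1 <;> by_cases h2 : v = 1 <;> simp [h1, h2] <;> omega
      rw [this]
      simp [Set.ncard_prod, pow_two])
    (by
      rintro ⟨⟨u, v⟩, w⟩
      rw [ncard_cell_cubeWreath]
      split_ifs <;> omega)
    (by
      rintro ⟨⟨u, v⟩, w⟩ ⟨⟨u', v'⟩, w'⟩ h1 h2
      rw [ncard_cell_cubeWreath] at h1 h2
      rw [← mem_cell_iff_cell_eq, mem_cell_cubeWreath]
      simp only at h1 h2 ⊢
      split_ifs at h1 h2 <;> first | omega | simp_all)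
    hM hMp
  have hall : ∀ x, (A.cell x).ncard ≤ p ^ 2 := by
    obtain ⟨f, hf⟩ := hA
    intro x
    have := hf.ncard_cell 1 x
    rw [inv_one, mul_one] at this
    rw [this, ncard_cell_cubeWreath]
    split_ifs <;> omega
  have hcoset : ∀ (N : Subgroup G) (x : G), (∀ y ∈ N, y * x ∈ A.cell x) →
      (A.cell x).ncard ≤ Nat.card N → A.cell x = (N : Set G) * {x} := by
    intro N x h hle
    symm
    refine Set.eq_of_subset_of_ncard_le ?_ ?_
    · rintro _ ⟨y, hy, _, rfl, rfl⟩
      exact h y hy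
    · rw [Set.mul_singleton, Set.ncard_image_of_injective _ (mul_left_injective x)]
      exact hle.trans (Nat.card_coe_set_eq (N : Set G)).le
  refine ⟨fun x hx => ?_, fun x hxM hxL => ?_, fun x hx => ?_⟩
  · symm
    refine Set.eq_of_subset_of_ncard_le (by simpa using A.mem_cell_self x) ?_
    rw [Set.ncard_singleton]
    exact (hL1 x).1 hx
  · exact hcoset L x (hL2 x hxL) (hLp ▸ (hM1 x).1 hxM)
  · exact hcoset M x (hM2 x hx) (hMp ▸ hall x)

end IteratedWreath

section Restrict

variable {G : Type*} [Group G] [Finite G] {A : SRing G} {U : Subgroup G}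

theorem image_cell_restrict (hU : A.IsASubgroup U) (u : U) :
    Subtype.val '' (A.restrict U hU).cell u = A.cell (u : G) :=
  (cell_eq_of_mem (show Subtype.val '' (A.restrict U hU).cell u ∈ A.basicSets from
    (A.restrict U hU).cell_mem_basicSets u)
    (Set.mem_image_of_mem _ ((A.restrict U hU).mem_cell_self u))).symm

theorem IsASubgroup.map_subtype (hU : A.IsASubgroup U) {V : Subgroup U}
    (hV : (A.restrict U hU).IsASubgroup V) : A.IsASubgroup (V.map U.subtype) := by
  refine isASet_iff.2 ?_
  rintro _ ⟨v, hv, rfl⟩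
  rw [Subgroup.coe_subtype, ← image_cell_restrict hU]
  rintro _ ⟨w, hw, rfl⟩
  exact ⟨w, IsASet.cell_subset hV hv hw, rfl⟩

end Restrict

section Basis

variable {p : ℕ} [Fact p.Prime] {G : Type*} [CommGroup G]

theorem natCard_sup_zpowers_le {a : G} (ha : a ^ p = 1) (N : Subgroup G) :
    Nat.card (N ⊔ Subgroup.zpowers a : Subgroup G) ≤ Nat.card N * p := by
  have h1 : ((N ⊔ Subgroup.zpowers a : Subgroup G) : Set G) = N * (Subgroup.zpowers a : Set G) :=
    Subgroup.mul_normal N _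
  have h2 := Set.natCard_mul_le (s := (N : Set G)) (t := (Subgroup.zpowers a : Set G))
  rw [← h1] at h2
  refine h2.trans (Nat.mul_le_mul_left _ ?_)
  have h3 : Nat.card (Subgroup.zpowers a) = orderOf a := Nat.card_zpowers a
  refine h3.le.trans ?_
  exact Nat.le_of_dvd (Fact.out : p.Prime).pos (orderOf_dvd_of_pow_eq_one ha)

/-- The basic sets inside an elementary abelian `A`-subgroup of rank three over which the S-ring is
isomorphic to `ℤC_p ≀ ℤC_p ≀ ℤC_p`. -/
theorem cells_of_isABasis [Finite G] {A : SRing G} {U : Subgroup G} (hU : A.IsASubgroup U) (hUp : Nat.card U = p ^ 3)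
    (hexp : ∀ u ∈ U, u ^ p = 1) (hA : Isomorphic (A.restrict U hU) (cubeWreath p)) {a b c : U}
    (habc : (A.restrict U hU).IsABasis ![a, b, c]) {L M : Subgroup G}
    (hL : L = Subgroup.zpowers (a : G)) (hM : M = L ⊔ Subgroup.zpowers (b : G)) :
    M ⊔ Subgroup.zpowers (c : G) = U ∧ Nat.card L = p ∧ Nat.card M = p ^ 2 ∧ A.IsASubgroup L ∧
      A.IsASubgroup M ∧
      (∀ x ∈ L, A.cell x = {x}) ∧ (∀ x ∈ M, x ∉ L → A.cell x = (L : Set G) * {x}) ∧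
      ∀ x ∈ U, x ∉ M → A.cell x = (M : Set G) * {x} := by
  obtain ⟨hgen, hinit⟩ := habc
  have hp := (Fact.out : p.Prime).pos
  have e0 : Subgroup.closure (![a, b, c] '' Set.Iic 0) = Subgroup.zpowers a := by
    rw [Subgroup.zpowers_eq_closure]
    congr 1
    ext x
    simp [eq_comm]
  have e1 : Subgroup.closure (![a, b, c] '' Set.Iic 1) =
      Subgroup.zpowers a ⊔ Subgroup.zpowers b := by
    rw [Subgroup.zpowers_eq_closure, Subgroup.zpowers_eq_closure, ← Subgroup.closure_union]
    congr 1
    ext x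
    simp [Fin.exists_fin_succ, eq_comm]
    tauto
  have e2 : Subgroup.closure (Set.range ![a, b, c]) =
      (Subgroup.zpowers a ⊔ Subgroup.zpowers b) ⊔ Subgroup.zpowers c := by
    rw [Subgroup.zpowers_eq_closure, Subgroup.zpowers_eq_closure, Subgroup.zpowers_eq_closure,
      ← Subgroup.closure_union, ← Subgroup.closure_union]
    congr 1
    ext x
    simp [eq_comm]
  set L' := Subgroup.zpowers a with hL'
  set M' := L' ⊔ Subgroup.zpowers b with hM'
  have hLL' : L = L'.map U.subtype := by rw [hL, hL', MonoidHom.map_zpowers]; rfl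
  have hMM' : M = M'.map U.subtype := by
    rw [hM, hLL', hM', Subgroup.map_sup, MonoidHom.map_zpowers _ b]; rfl
  have hexp' : ∀ u : U, u ^ p = 1 := fun u => Subtype.ext (hexp u u.2)
  -- Each generator multiplies the order by at most `p`, and the total is `p ^ 3`, so every bound is
  -- attained.
  have hL1 : Nat.card L' ≤ p := by
    rw [hL', Nat.card_zpowers]
    exact Nat.le_of_dvd hp (orderOf_dvd_of_pow_eq_one (hexp' a))
  have hM1 : Nat.card M' ≤ Nat.card L' * p := natCard_sup_zpowers_le (hexp' b) L'
  have hU1 : p ^ 3 ≤ Nat.card M' * p := by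
    have h := natCard_sup_zpowers_le (hexp' c) M'
    rw [← e2, hgen, Subgroup.card_top, hUp] at h
    exact h
  have hMp : p ^ 2 ≤ Nat.card M' := Nat.le_of_mul_le_mul_right (by linarith [pow_succ p 2]) hp
  have hLp : p ≤ Nat.card L' := Nat.le_of_mul_le_mul_right (by nlinarith) hp
  have hLeq : Nat.card L' = p := le_antisymm hL1 hLp
  have hMeq : Nat.card M' = p ^ 2 := le_antisymm (by nlinarith) hMp
  have hLA : (A.restrict U hU).IsASubgroup L' := e0 ▸ hinit 0
  have hMA : (A.restrict U hU).IsASubgroup M' := e1 ▸ hinit 1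
  obtain ⟨h1, h2, h3⟩ := cells_of_isomorphic_cubeWreath hA hLA hMA hLeq hMeq
  have hinj := U.subtype_injective
  have hmem : ∀ (V : Subgroup U) (u : U), (u : G) ∈ V.map U.subtype ↔ u ∈ V := fun V u =>
    Subgroup.mem_map_iff_mem hinj
  have himg : ∀ (V : Subgroup U) (u : U), Subtype.val '' ((V : Set U) * {u}) =
      ((V.map U.subtype : Subgroup G) : Set G) * {(u : G)} := by
    intro V u
    rw [← Subgroup.coe_subtype, Set.image_mul, Set.image_singleton]
    rfl
  have hLU : L ≤ U := hLL' ▸ Subgroup.map_subtype_le L'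
  have hMU : M ≤ U := hMM' ▸ Subgroup.map_subtype_le M'
  refine ⟨?_, ?_, ?_, ?_, ?_, ?_, ?_, ?_⟩
  · have h := congrArg (Subgroup.map U.subtype) (e2.symm.trans hgen)
    rw [Subgroup.map_sup, ← hMM', MonoidHom.map_zpowers] at h
    simpa [← MonoidHom.range_eq_map] using h
  · rw [hLL', Subgroup.card_map_of_injective hinj, hLeq]
  · rw [hMM', Subgroup.card_map_of_injective hinj, hMeq]
  · exact hLL' ▸ hU.map_subtype hLA
  · exact hMM' ▸ hU.map_subtype hMA
  · intro x hx
    lift x to U using hLU hx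
    rw [hLL', hmem] at hx
    rw [← image_cell_restrict hU, h1 x hx, Set.image_singleton]
  · intro x hx hxL
    lift x to U using hMU hx
    rw [hMM', hmem] at hx
    rw [hLL', hmem] at hxL
    rw [← image_cell_restrict hU, h2 x hx hxL, himg, hLL']
  · intro x hx hxM
    lift x to U using hx
    rw [hMM', hmem] at hxM
    rw [← image_cell_restrict hU, h3 x hxM, himg, hMM']

end Basis

end SRing

/-! ### The splitting of `H` and its multipliers -/

/-- `H` is the direct product of an elementary abelian `p`-group `P` of rank three and a group `Q`
of prime order `q ≠ p` generated by `d`. -/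
structure IsCubePrimeSplit {H : Type*} [CommGroup H] (p q : ℕ) (P Q : Subgroup H) (d : H) :
    Prop where
  ne : p ≠ q
  card_eq : Nat.card H = p ^ 3 * q
  card_left : Nat.card P = p ^ 3
  pow_left : ∀ h ∈ P, h ^ p = 1
  zpowers_eq : Subgroup.zpowers d = Q
  pow_right : d ^ q = 1
  ne_one : d ≠ 1
  inf_eq : P ⊓ Q = ⊥
  sup_eq : P ⊔ Q = ⊤

namespace IsCubePrimeSplit

variable {p q : ℕ} {H : Type*} [CommGroup H] {P Q : Subgroup H} {d : H}

theorem mem_right (hs : IsCubePrimeSplit p q P Q d) : d ∈ Q :=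
  hs.zpowers_eq ▸ Subgroup.mem_zpowers d

theorem eq_one (hs : IsCubePrimeSplit p q P Q d) {g : H} (hP : g ∈ P) (hQ : g ∈ Q) : g = 1 := by
  have : g ∈ P ⊓ Q := ⟨hP, hQ⟩
  rwa [hs.inf_eq, Subgroup.mem_bot] at this

theorem exists_mul_eq (hs : IsCubePrimeSplit p q P Q d) (g : H) :
    ∃ h ∈ P, ∃ x ∈ Q, h * x = g := by
  have : g ∈ P ⊔ Q := hs.sup_eq ▸ Subgroup.mem_top g
  exact Subgroup.mem_sup.1 this

theorem eq_of_mul_eq (hs : IsCubePrimeSplit p q P Q d) {h h' x x' : H} (hh : h ∈ P) (hh' : h' ∈ P)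
    (hx : x ∈ Q) (hx' : x' ∈ Q) (e : h * x = h' * x') : h = h' ∧ x = x' := by
  have e1 : h'⁻¹ * h = x' * x⁻¹ := by
    rw [inv_mul_eq_iff_eq_mul, ← mul_assoc, ← e, mul_inv_cancel_right]
  have e2 : h'⁻¹ * h = 1 :=
    hs.eq_one (P.mul_mem (P.inv_mem hh') hh) (e1 ▸ Q.mul_mem hx' (Q.inv_mem hx))
  have e3 : h = h' := (inv_mul_eq_one.1 e2).symm
  subst e3
  exact ⟨rfl, mul_left_cancel e⟩

theorem exists_pow_eq (hs : IsCubePrimeSplit p q P Q d) [Finite H] {x : H} (hx : x ∈ Q) :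
    ∃ n : ℕ, d ^ n = x := by
  rw [← hs.zpowers_eq, ← mem_powers_iff_mem_zpowers] at hx
  exact hx

/-- By the Chinese remainder theorem a multiplier can act on `P` and on `Q` by independently chosen
exponents. -/
theorem exists_multiplier [Fact p.Prime] [Fact q.Prime] [Finite H]
    (hs : IsCubePrimeSplit p q P Q d) {i : ℕ}
    (hi : ¬ p ∣ i) {x : H} (hx : x ∈ Q) (hx1 : x ≠ 1) :
    ∃ m : ℕ, (Nat.card H).Coprime m ∧ (∀ h ∈ P, h ^ m = h ^ i) ∧ d ^ m = x := by
  have hp : p.Prime := Fact.out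
  have hq : q.Prime := Fact.out
  obtain ⟨j, rfl⟩ := hs.exists_pow_eq hx
  have hj : ¬ q ∣ j := by
    rintro ⟨r, rfl⟩
    exact hx1 (by rw [pow_mul, hs.pow_right, one_pow])
  obtain ⟨m, hm1, hm2⟩ := Nat.chineseRemainder ((Nat.coprime_primes hp hq).2 hs.ne) i j
  have hpow : ∀ {g : H} {r m n : ℕ}, g ^ r = 1 → m ≡ n [MOD r] → g ^ m = g ^ n := by
    intro g r m n hg hmn
    exact pow_eq_pow_iff_modEq.2 (hmn.of_dvd (orderOf_dvd_of_pow_eq_one hg))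
  refine ⟨m, ?_, fun h hh => hpow (hs.pow_left h hh) hm1, hpow hs.pow_right hm2⟩
  rw [hs.card_eq]
  refine Nat.Coprime.mul_left (Nat.Coprime.pow_left 3 ?_) ?_
  · exact hp.coprime_iff_not_dvd.2 fun h => hi ((hm1.dvd_iff dvd_rfl).1 h)
  · exact hq.coprime_iff_not_dvd.2 fun h => hj ((hm2.dvd_iff dvd_rfl).1 h)

end IsCubePrimeSplit

namespace SRing

theorem apply_mem_of_image_eq {G : Type*} {f : Equiv.Perm G} {S : Set G} (hS : f '' S = S) {g : G}
    (hg : g ∈ S) : f g ∈ S :=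
  hS ▸ Set.mem_image_of_mem f hg

/-! ### Normalized isomorphisms on cosets and on the sets of `vd` -/

section Image

variable {G : Type*} [CommGroup G] [Finite G] {A : SRing G} {f : Equiv.Perm G}

theorem mem_isoOne_of_mem_aut (hf : f ∈ A.aut) (h1 : f 1 = 1) : f ∈ A.isoOne :=
  ⟨⟨A, Set.image_congr fun X hX => hf X hX⟩, h1⟩

theorem image_eq_of_mem_aut (hf : f ∈ A.aut) (h1 : f 1 = 1) {S : Set G} (hS : A.IsASet S) :
    f '' S = S := by
  refine Set.eq_of_subset_of_ncard_le ?_ (Set.ncard_image_of_injective _ f.injective).ge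
  rintro _ ⟨g, hg, rfl⟩
  exact hS.cell_subset hg (apply_mem_cell_of_mem_aut hf h1 g)

theorem image_eq_of_forall_image_cell_eq {S : Set G} (hS : A.IsASet S)
    (h : ∀ g ∈ S, f '' A.cell g = A.cell g) : f '' S = S := by
  refine Set.eq_of_subset_of_ncard_le ?_ (Set.ncard_image_of_injective _ f.injective).ge
  rintro _ ⟨g, hg, rfl⟩
  exact hS.cell_subset hg (apply_mem_of_image_eq (h g hg) (A.mem_cell_self g))

/-- Cosets of `N` inside `N ⊔ ⟨v⟩` are preserved by a normalized isomorphism that preserves `N`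
and `Nv`. -/
theorem isASet_coset_of_mem_sup_zpowers (hf : f ∈ A.isoOne) {N : Subgroup G}
    (hN : A.IsASubgroup N) (hfN : f '' N = N) {v : G} (hv : A.IsASet ((N : Set G) * {v}))
    (hfv : f v ∈ (N : Set G) * {v}) {x : G} (hx : x ∈ N ⊔ Subgroup.zpowers v) :
    A.IsASet ((N : Set G) * {x}) ∧ f '' ((N : Set G) * {x}) = (N : Set G) * {x} := by
  have hNN : (N : Set G) * N = N := coe_mul_coe N
  have hcoset : ∀ {y z : G}, y ∈ (N : Set G) * {z} → (N : Set G) * {y} = (N : Set G) * {z} := by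
    intro y z hy
    obtain ⟨n, hn, w, hw, rfl⟩ := hy
    obtain rfl : w = z := hw
    have : ({n * w} : Set G) = {n} * {w} := (Set.singleton_mul_singleton).symm
    change (N : Set G) * {n * w} = _
    rw [this, ← mul_assoc, Subgroup.subgroup_mul_singleton hn]
  have hfv' : f '' ((N : Set G) * {v}) = (N : Set G) * {v} := by
    rw [image_mul_of_mem_isoOne hf hN, hfN, Set.image_singleton, hcoset hfv]
  -- The coset of `v ^ n` is an iterated product of copies of the coset `Nv`, and `f` respects
  -- products of `A`-sets.
  have key : ∀ n : ℕ, A.IsASet ((N : Set G) * {v ^ n}) ∧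
      f '' ((N : Set G) * {v ^ n}) = (N : Set G) * {v ^ n} := by
    intro n
    induction n with
    | zero =>
      rw [pow_zero, Set.singleton_one, mul_one]
      exact ⟨hN, hfN⟩
    | succ n ih =>
      have e : (N : Set G) * {v ^ (n + 1)} = (N * {v ^ n}) * (N * {v}) := by
        rw [mul_mul_mul_comm, hNN, Set.singleton_mul_singleton, pow_succ]
      rw [e]
      exact ⟨ih.1.mul hv, by rw [image_mul_of_mem_isoOne hf ih.1, ih.2, hfv']⟩
  obtain ⟨n, hn, z, hz, rfl⟩ := Subgroup.mem_sup.1 hx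
  rw [← mem_powers_iff_mem_zpowers] at hz
  obtain ⟨i, rfl⟩ := hz
  rw [hcoset (y := n * v ^ i) (z := v ^ i) ⟨n, hn, _, rfl, rfl⟩]
  exact key i

end Image

section Split

variable {p q : ℕ} {H : Type*} [CommGroup H] [Finite H]
  {P Q : Subgroup H} {d : H} {A : SRing H} {f : Equiv.Perm H}

/-- `f '' Q` is closed under multiplication because `QQ = Q`, and it contains the generator `d`. -/
theorem image_right_eq (hs : IsCubePrimeSplit p q P Q d) (hQ : A.IsASubgroup Q)
    (hf : f ∈ A.isoOne) (hfd : f d = d) : f '' Q = Q := by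
  have hQQ : (f '' Q) * (f '' Q) = f '' Q := by
    rw [← image_mul_of_mem_isoOne hf hQ, coe_mul_coe]
  symm
  refine Set.eq_of_subset_of_ncard_le ?_ (Set.ncard_image_of_injective _ f.injective).le
  intro x hx
  obtain ⟨n, rfl⟩ := hs.exists_pow_eq hx
  induction n with
  | zero => exact ⟨1, Q.one_mem, by rw [hf.2, pow_zero]⟩
  | succ n ih =>
    rw [pow_succ, ← hQQ]
    exact Set.mul_mem_mul (ih (Q.pow_mem hs.mem_right n)) ⟨d, hs.mem_right, hfd⟩

/-- `f (h * x)` lies both in `P * f x` and in `Q * f h`, and factorization along `P` and `Q` is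
unique. -/
theorem apply_mul_of_mem (hs : IsCubePrimeSplit p q P Q d) (hP : A.IsASubgroup P)
    (hQ : A.IsASubgroup Q) (hf : f ∈ A.isoOne) (hfP : f '' P = P) (hfQ : f '' Q = Q) {h x : H}
    (hh : h ∈ P) (hx : x ∈ Q) : f (h * x) = f h * f x := by
  obtain ⟨h', hh', _, rfl, e1⟩ := hfP ▸ image_mem_mul_of_mem_isoOne hf hP (g := x) (h := h * x)
    ⟨h, hh, x, rfl, rfl⟩
  obtain ⟨x', hx', _, rfl, e2⟩ := hfQ ▸ image_mem_mul_of_mem_isoOne hf hQ (g := h) (h := h * x)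
    ⟨x, hx, h, rfl, mul_comm _ _⟩
  simp only at e1 e2
  rw [mul_comm x'] at e2
  have hfh : f h ∈ P := apply_mem_of_image_eq hfP hh
  have hfx : f x ∈ Q := apply_mem_of_image_eq hfQ hx
  obtain ⟨e3, -⟩ := hs.eq_of_mul_eq hh' hfh hfx hx' (e1.trans e2.symm)
  rw [← e1, e3]

/-- The key step: a normalized isomorphism which preserves the cosets of `N` in `N'`, maps `v` into
`Nv` and fixes `d` preserves the basic set of `vd`, provided this is a union of cosets of `N`. -/
theorem image_cell_mul_eq [Fact p.Prime] [Fact q.Prime] (hs : IsCubePrimeSplit p q P Q d) (hP : A.IsASubgroup P)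
    (hQ : A.IsASubgroup Q) (hf : f ∈ A.isoOne) (hfP : f '' P = P) (hfd : f d = d)
    {N N' : Subgroup H} (hN' : N' ≤ P)
    (hcos : ∀ y ∈ N', A.IsASet ((N : Set H) * {y}) ∧
      f '' ((N : Set H) * {y}) = (N : Set H) * {y})
    {v : H} (hv : v ∈ P) (hV : A.IsASet ((N' : Set H) * {v})) (hfv : f v ∈ (N : Set H) * {v})
    (hX : (N : Set H) * A.cell (v * d) = A.cell (v * d)) :
    f '' A.cell (v * d) = A.cell (v * d) := by
  have hone := hcos 1 N'.one_mem
  rw [Set.singleton_one, mul_one] at hone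
  have hNA : A.IsASet (N : Set H) := hone.1
  have hfX : (N : Set H) * f '' A.cell (v * d) = f '' A.cell (v * d) := by
    conv_rhs => rw [← hX, image_mul_of_mem_isoOne hf hNA, hone.2]
  have hfQ := image_right_eq hs hQ hf hfd
  -- `f (v * d) = f v * d` lies in the `N`-coset of `v * d`, and `f '' A.cell (v * d)` is
  -- `N`-invariant.
  have hmem : v * d ∈ f '' A.cell (v * d) := by
    obtain ⟨n, hn, v', hv', e⟩ := hfv
    rw [Set.mem_singleton_iff.1 hv'] at e
    rw [← hfX]
    refine ⟨n⁻¹, N.inv_mem hn, f (v * d), Set.mem_image_of_mem f (A.mem_cell_self _), ?_⟩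
    simp only at e ⊢
    rw [apply_mul_of_mem hs hP hQ hf hfP hfQ hv hs.mem_right, ← e, hfd]
    group
  symm
  refine Set.eq_of_subset_of_ncard_le ?_ (Set.ncard_image_of_injective _ f.injective).le
  intro w hw
  have hw' : w ∈ ((N' : Set H) * {v}) * Q := by
    refine (hV.mul hQ).cell_subset ?_ hw
    exact ⟨v, ⟨1, N'.one_mem, v, rfl, one_mul v⟩, d, hs.mem_right, rfl⟩
  obtain ⟨_, ⟨y, hy, v', hv', rfl⟩, x, hx, rfl⟩ := hw'
  simp only [Set.mem_singleton_iff.1 hv'] at hw ⊢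
  have hx1 : x ≠ 1 := by
    rintro rfl
    have h1 : y * v * 1 ∈ P := P.mul_mem (P.mul_mem (hN' hy) hv) P.one_mem
    have h2 : v * d ∈ P := IsASet.cell_subset hP h1 (mem_cell_comm.1 hw)
    exact hs.ne_one (hs.eq_one ((P.mul_mem_cancel_left hv).1 h2) hs.mem_right)
  -- For `w = y * v * x`, a multiplier trivial on `P` takes `v * d` to `v * x = y⁻¹ * w`.
  obtain ⟨m, hm, hmP, hmd⟩ := hs.exists_multiplier (i := 1)
    (fun h => (Fact.out : p.Prime).one_lt.ne' (Nat.dvd_one.1 h)) hx hx1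
  have hpow : (v * d) ^ m = v * x := by rw [mul_pow, hmP v hv, pow_one, hmd]
  obtain ⟨hyA, hyf⟩ := hcos y⁻¹ (N'.inv_mem hy)
  have htr : ((N : Set H) * {y⁻¹}) * A.cell (v * d) = {y⁻¹} * A.cell (v * d) := by
    rw [mul_comm (N : Set H), mul_assoc, hX]
  -- The basic set of `v * x` is thus both a multiplier image and a translate by `y⁻¹` of the one of
  -- `v * d`. Writing the translate as a product with the `A`-set `N * {y⁻¹}` lets `f` pass through
  -- it.
  have heq : A.cell (v * x) = ((N : Set H) * {y⁻¹}) * A.cell (v * d) := by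
    refine Set.eq_of_subset_of_ncard_le ?_ ?_
    · refine (hyA.mul (A.isASet_cell _)).cell_subset ?_
      rw [htr]
      exact ⟨y⁻¹, rfl, _, hw, by simp only; group⟩
    · rw [htr, Set.singleton_mul, Set.ncard_image_of_injective _ (mul_right_injective _), ← hpow,
        ← image_pow_cell hm,
        Set.ncard_image_of_injective _ (Nat.Coprime.pow_left_bijective hm).1]
  have hvx : v * x ∈ f '' A.cell (v * x) := by
    rw [← hpow, ← image_pow_cell hm, (image_pow_of_coprime hf hm (A.isASet_cell _)).2]
    exact ⟨_, hmem, rfl⟩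
  rw [heq, image_mul_of_mem_isoOne hf hyA, hyf] at hvx
  obtain ⟨_, ⟨n, hn, _, rfl, rfl⟩, z, hz, e⟩ := hvx
  rw [← hfX]
  refine ⟨n, hn, z, hz, ?_⟩
  simp only at e ⊢
  rw [mul_assoc y, ← e]
  rw [show y * (n * y⁻¹ * z) = (y * y⁻¹) * (n * z) by ac_rfl, mul_inv_cancel, one_mul]

end Split

end SRing

/-! ### The flag `L < M < P` and the two preservation criteria -/

namespace SRing

/-- The flag `1 < L < M < P` of `A`-subgroups attached to an `A`-basis `(a, b, c)` of `P`, outside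
which the basic sets are the cosets of the preceding member. -/
structure IsWreathFlag {H : Type*} [CommGroup H] [Finite H] (A : SRing H) (p : ℕ)
    (P L M : Subgroup H) (a b c : H) : Prop where
  left_eq : Subgroup.zpowers a = L
  mid_eq : L ⊔ Subgroup.zpowers b = M
  right_eq : M ⊔ Subgroup.zpowers c = P
  card_left : Nat.card L = p
  card_mid : Nat.card M = p ^ 2
  card_right : Nat.card P = p ^ 3
  isASubgroup_left : A.IsASubgroup L
  isASubgroup_mid : A.IsASubgroup M
  isASubgroup_right : A.IsASubgroup P
  cell_left : ∀ x ∈ L, A.cell x = {x}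
  cell_mid : ∀ x ∈ M, x ∉ L → A.cell x = (L : Set H) * {x}
  cell_right : ∀ x ∈ P, x ∉ M → A.cell x = (M : Set H) * {x}

namespace IsWreathFlag

variable {p : ℕ} {H : Type*} [CommGroup H] [Finite H] {A : SRing H}
  {P L M : Subgroup H} {a b c : H}

theorem mem_left (hw : IsWreathFlag A p P L M a b c) : a ∈ L :=
  hw.left_eq ▸ Subgroup.mem_zpowers a

theorem left_le (hw : IsWreathFlag A p P L M a b c) : L ≤ M :=
  hw.mid_eq ▸ le_sup_left

theorem mid_le (hw : IsWreathFlag A p P L M a b c) : M ≤ P :=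
  hw.right_eq ▸ le_sup_left

theorem mem_mid (hw : IsWreathFlag A p P L M a b c) : b ∈ M :=
  hw.mid_eq ▸ (le_sup_right : _ ≤ L ⊔ Subgroup.zpowers b) (Subgroup.mem_zpowers b)

theorem mem_right (hw : IsWreathFlag A p P L M a b c) : c ∈ P :=
  hw.right_eq ▸ (le_sup_right : _ ≤ M ⊔ Subgroup.zpowers c) (Subgroup.mem_zpowers c)

theorem notMem_left [Fact p.Prime] (hw : IsWreathFlag A p P L M a b c) : b ∉ L := by
  intro hb
  have h1 : L = M := by
    rw [← hw.mid_eq, left_eq_sup, Subgroup.zpowers_le]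
    exact hb
  have h2 := hw.card_mid
  have h3 := (Fact.out : p.Prime).two_le
  rw [← h1, hw.card_left] at h2
  nlinarith

theorem notMem_mid [Fact p.Prime] (hw : IsWreathFlag A p P L M a b c) : c ∉ M := by
  intro hc
  have h1 : M = P := by
    rw [← hw.right_eq, left_eq_sup, Subgroup.zpowers_le]
    exact hc
  have h2 := hw.card_right
  have h3 := (Fact.out : p.Prime).two_le
  rw [← h1, hw.card_mid] at h2
  nlinarith [pow_pos (Fact.out : p.Prime).pos 2]

variable {f : Equiv.Perm H}

/-- Climbing the flag: preservation of the cosets at one level gives preservation of the next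
subgroup, whose cosets are then generated by that of the next basis element. -/
theorem image_cosets [Fact p.Prime] (hw : IsWreathFlag A p P L M a b c) (hf : f ∈ A.isoOne) (hfa : f a = a)
    (hfb : f b = b) (hfc : f c ∈ (L : Set H) * {c}) :
    (∀ x ∈ L, A.IsASet (((⊥ : Subgroup H) : Set H) * {x}) ∧
      f '' (((⊥ : Subgroup H) : Set H) * {x}) = ((⊥ : Subgroup H) : Set H) * {x}) ∧
    (∀ x ∈ M, A.IsASet ((L : Set H) * {x}) ∧ f '' ((L : Set H) * {x}) = (L : Set H) * {x}) ∧
    ∀ x ∈ P, A.IsASet ((M : Set H) * {x}) ∧ f '' ((M : Set H) * {x}) = (M : Set H) * {x} := by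
  have hself : ∀ (N : Subgroup H) (x : H), x ∈ (N : Set H) * {x} := fun N x =>
    ⟨1, N.one_mem, x, rfl, one_mul x⟩
  have hsub : ∀ (N N' : Subgroup H), N ≤ N' → (∀ x ∈ N', A.IsASet ((N : Set H) * {x}) ∧
      f '' ((N : Set H) * {x}) = (N : Set H) * {x}) → f '' N' = N' := by
    intro N N' hN h
    refine Set.eq_of_subset_of_ncard_le ?_ (Set.ncard_image_of_injective _ f.injective).ge
    rintro _ ⟨x, hx, rfl⟩
    obtain ⟨n, hn, x', hx', e⟩ := apply_mem_of_image_eq (h x hx).2 (hself N x)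
    rw [Set.mem_singleton_iff.1 hx'] at e
    rw [← e]
    exact N'.mul_mem (hN hn) hx
  have hbot : A.IsASubgroup ⊥ := A.isASet_one
  have h1 : ∀ x ∈ L, A.IsASet (((⊥ : Subgroup H) : Set H) * {x}) ∧
      f '' (((⊥ : Subgroup H) : Set H) * {x}) = ((⊥ : Subgroup H) : Set H) * {x} := by
    intro x hx
    refine isASet_coset_of_mem_sup_zpowers hf hbot (by simp [hf.2]) (v := a) ?_ ?_ ?_
    · have := hw.cell_left a hw.mem_left ▸ A.isASet_cell a
      simpa using this
    · rw [hfa]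
      exact hself ⊥ a
    · rwa [bot_sup_eq, hw.left_eq]
  have h2 : ∀ x ∈ M, A.IsASet ((L : Set H) * {x}) ∧
      f '' ((L : Set H) * {x}) = (L : Set H) * {x} := by
    intro x hx
    refine isASet_coset_of_mem_sup_zpowers hf hw.isASubgroup_left (hsub ⊥ L bot_le h1) (v := b)
      (hw.cell_mid b hw.mem_mid hw.notMem_left ▸ A.isASet_cell b) ?_ ?_
    · rw [hfb]
      exact hself L b
    · rwa [hw.mid_eq]
  refine ⟨h1, h2, fun x hx => ?_⟩
  refine isASet_coset_of_mem_sup_zpowers hf hw.isASubgroup_mid (hsub L M hw.left_le h2) (v := c)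
    (hw.cell_right c hw.mem_right hw.notMem_mid ▸ A.isASet_cell c) ?_ ?_
  · exact Set.mul_subset_mul_right (show (L : Set H) ⊆ M from hw.left_le) hfc
  · rwa [hw.right_eq]

theorem image_cell [Fact p.Prime] (hw : IsWreathFlag A p P L M a b c) (hf : f ∈ A.isoOne) (hfa : f a = a)
    (hfb : f b = b) (hfc : f c ∈ (L : Set H) * {c}) {x : H} (hx : x ∈ P) :
    f '' A.cell x = A.cell x := by
  obtain ⟨h1, h2, h3⟩ := hw.image_cosets hf hfa hfb hfc
  by_cases hxM : x ∈ M
  · by_cases hxL : x ∈ L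
    · have := (h1 x hxL).2
      rw [hw.cell_left x hxL]
      simpa using this
    · rw [hw.cell_mid x hxM hxL]
      exact (h2 x hxM).2
  · rw [hw.cell_right x hx hxM]
    exact (h3 x hx).2

theorem image_right [Fact p.Prime] (hw : IsWreathFlag A p P L M a b c) (hf : f ∈ A.isoOne) (hfa : f a = a)
    (hfb : f b = b) (hfc : f c ∈ (L : Set H) * {c}) : f '' P = P :=
  image_eq_of_forall_image_cell_eq hw.isASubgroup_right fun _ hx => hw.image_cell hf hfa hfb hfc hx

end IsWreathFlag

/-- Writing `h = y₀ * v ^ i`, take for `y` the `j`-th power of `y₀` with `i * j ≡ 1` modulo `p`.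
This reduces `h` by a multiplier to an element of `Nv`, where `f` is controlled. -/
theorem exists_pow_mul_eq {p : ℕ} [Fact p.Prime] {H : Type*} [CommGroup H] [Finite H]
    {N : Subgroup H} {v h : H} (hexp : ∀ y ∈ N ⊔ Subgroup.zpowers v, y ^ p = 1)
    (hh : h ∈ N ⊔ Subgroup.zpowers v) (hN : h ∉ N) :
    ∃ y ∈ N, ∃ i : ℕ, ¬ p ∣ i ∧ (y * v) ^ i = h := by
  obtain ⟨y, hy, z, hz, rfl⟩ := Subgroup.mem_sup.1 hh
  rw [← mem_powers_iff_mem_zpowers] at hz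
  obtain ⟨i, rfl⟩ := hz
  have hv : v ^ p = 1 := hexp v (Subgroup.mem_sup_right (Subgroup.mem_zpowers v))
  have hyp : y ^ p = 1 := hexp y (Subgroup.mem_sup_left hy)
  have hi : ¬ p ∣ i := by
    rintro ⟨r, rfl⟩
    simp only [pow_mul, hv, one_pow, mul_one] at hN
    exact hN hy
  obtain ⟨j, -, hj⟩ := Nat.exists_mul_mod_eq_one_of_coprime
    (((Fact.out : p.Prime).coprime_iff_not_dvd.2 hi).symm) (Fact.out : p.Prime).one_lt
  refine ⟨y ^ j, N.pow_mem hy j, i, hi, ?_⟩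
  have : y ^ (j * i) = y := by
    rw [← Nat.div_add_mod (j * i) p, mul_comm j i, hj, pow_add, pow_mul, hyp, one_pow, one_mul,
      pow_one]
  rw [mul_pow, ← pow_mul, this]

section Assembly

variable {p q : ℕ} [Fact p.Prime] {H : Type*} [CommGroup H] [Finite H]
  {P Q L M : Subgroup H} {a b c d : H} {A : SRing H} {f : Equiv.Perm H}

/-- The key step is applied with `(N, N')` equal to `(⊥, ⊥)`, `(⊥, L)`, `(L, M)` according to
whether the `P`-part lies in `L`, `M \ L` or `P \ M`; multipliers reach the remaining elements. Only
the last case needs invariance, because there `f` is known only up to `L`. -/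
theorem image_cell_eq_of_forall_mul_cell_eq [Fact q.Prime] (hs : IsCubePrimeSplit p q P Q d)
    (hw : IsWreathFlag A p P L M a b c) (hQ : A.IsASubgroup Q) (hf : f ∈ A.isoOne) (hfa : f a = a)
    (hfb : f b = b) (hfc : f c ∈ (L : Set H) * {c}) (hfd : f d = d)
    (hinv : ∀ v ∈ P, v ∉ M → (L : Set H) * A.cell (v * d) = A.cell (v * d)) (g : H) :
    f '' A.cell g = A.cell g := by
  obtain ⟨h1, h2, h3⟩ := hw.image_cosets hf hfa hfb hfc
  have hP := hw.isASubgroup_right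
  have hfP := hw.image_right hf hfa hfb hfc
  have hbotmul : ∀ S : Set H, ((⊥ : Subgroup H) : Set H) * S = S := fun S => by
    rw [Subgroup.coe_bot, Set.singleton_mul]
    simp
  have hfixL : ∀ y ∈ L, f y = y := fun y hy => by
    have := (h1 y hy).2
    rw [hbotmul, Set.image_singleton] at this
    exact Set.singleton_eq_singleton_iff.1 this
  have hmul : ∀ {i : ℕ}, ¬ p ∣ i → ∀ {v x : H}, v ∈ P → x ∈ Q → x ≠ 1 →
      f '' A.cell (v * d) = A.cell (v * d) → f '' A.cell (v ^ i * x) = A.cell (v ^ i * x) := by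
    intro i hi v x hv hx hx1 h
    obtain ⟨m, hm, hmP, hmd⟩ := hs.exists_multiplier hi hx hx1
    have e : (v * d) ^ m = v ^ i * x := by rw [mul_pow, hmP v hv, hmd]
    rw [← e]
    exact image_cell_pow hf hm h
  obtain ⟨h, hh, x, hx, rfl⟩ := hs.exists_mul_eq g
  by_cases hx1 : x = 1
  · rw [hx1, mul_one]
    exact hw.image_cell hf hfa hfb hfc hh
  have hp1 : ¬ p ∣ 1 := fun h => (Fact.out : p.Prime).one_lt.ne' (Nat.dvd_one.1 h)
  by_cases hhM : h ∈ M
  · by_cases hhL : h ∈ L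
    · have key := hmul hp1 hh hx hx1 (image_cell_mul_eq hs hP hQ hf hfP hfd (N := ⊥) (N' := ⊥)
        bot_le (fun y hy => h1 y (Subgroup.mem_bot.1 hy ▸ L.one_mem)) hh (h1 h hhL).1
        (by rw [hbotmul, hfixL h hhL]; rfl) (hbotmul _))
      rwa [pow_one] at key
    · obtain ⟨y, hy, i, hi, rfl⟩ := exists_pow_mul_eq (p := p) (v := b) (N := L) (h := h)
        (fun z hz => hs.pow_left z (hw.mid_le (hw.mid_eq ▸ hz))) (hw.mid_eq.symm ▸ hhM) hhL
      have hyb : y * b ∈ M := M.mul_mem (hw.left_le hy) hw.mem_mid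
      have hfyb : f (y * b) = y * b := by
        have := image_mem_mul_of_mem_isoOne hf (h1 y hy).1 (g := b) (h := y * b)
          (by rw [hbotmul]; exact ⟨y, rfl, b, rfl, rfl⟩)
        rw [(h1 y hy).2, hbotmul, hfb, Set.singleton_mul_singleton] at this
        exact this
      exact hmul hi (hw.mid_le hyb) hx hx1 (image_cell_mul_eq hs hP hQ hf hfP hfd (N := ⊥)
        (N' := L) (hw.left_le.trans hw.mid_le) h1 (hw.mid_le hyb) (h2 _ hyb).1
        (by rw [hbotmul, hfyb]; rfl) (hbotmul _))
  · obtain ⟨y, hy, i, hi, rfl⟩ := exists_pow_mul_eq (p := p) (v := c) (N := M) (h := h)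
      (fun z hz => hs.pow_left z (hw.right_eq ▸ hz)) (hw.right_eq.symm ▸ hh) hhM
    have hyc : y * c ∈ P := P.mul_mem (hw.mid_le hy) hw.mem_right
    have hycM : y * c ∉ M := fun hmem => hw.notMem_mid ((M.mul_mem_cancel_left hy).1 hmem)
    have hfyc : f (y * c) ∈ (L : Set H) * {y * c} := by
      have := image_mem_mul_of_mem_isoOne hf (h2 y hy).1 (g := c) (h := y * c)
        ⟨y, ⟨1, L.one_mem, y, rfl, one_mul y⟩, c, rfl, rfl⟩
      rw [(h2 y hy).2] at this
      obtain ⟨l, hl, c', hc', e⟩ := hfc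
      rw [Set.mem_singleton_iff.1 hc'] at e
      rw [← e] at this
      obtain ⟨_, ⟨l', hl', y', hy', rfl⟩, z, hz, e'⟩ := this
      rw [← e', Set.mem_singleton_iff.1 hz, Set.mem_singleton_iff.1 hy']
      exact ⟨l' * l, L.mul_mem hl' hl, y * c, rfl, by simp only; ac_rfl⟩
    exact hmul hi hyc hx hx1 (image_cell_mul_eq hs hP hQ hf hfP hfd (N := L) (N' := M)
      hw.mid_le h2 hyc (h3 _ hyc).1 hfyc (hinv _ hyc hycM))

/-- Under `htr` the basic set of `h * x` with `x ≠ 1` is the product of the basic set of `h` and `Q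
\ {1}`, both of which `f` preserves. -/
theorem image_cell_eq_of_forall_mul_mem_cell (hs : IsCubePrimeSplit p q P Q d)
    (hw : IsWreathFlag A p P L M a b c) (hQ : A.IsASubgroup Q) (hf : f ∈ A.isoOne) (hfa : f a = a)
    (hfb : f b = b) (hfc : f c ∈ (L : Set H) * {c}) (hfd : f d = d)
    (htr : ∀ h ∈ P, ∀ x ∈ Q, ∀ y ∈ Q, x ≠ 1 → y ≠ 1 → h * y ∈ A.cell (h * x)) (g : H) :
    f '' A.cell g = A.cell g := by
  have hP := hw.isASubgroup_right
  have hfQ := image_right_eq hs hQ hf hfd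
  obtain ⟨h, hh, x, hx, rfl⟩ := hs.exists_mul_eq g
  by_cases hx1 : x = 1
  · rw [hx1, mul_one]
    exact hw.image_cell hf hfa hfb hfc hh
  have hcellx : A.cell x = (Q : Set H) \ {1} := by
    apply Set.Subset.antisymm
    · intro y hy
      refine ⟨IsASet.cell_subset hQ hx hy, ?_⟩
      rintro rfl
      have := cell_eq_of_mem A.singleton_one_mem rfl ▸ mem_cell_comm.1 hy
      exact hx1 this
    · rintro y ⟨hy, hy1⟩
      have := htr 1 P.one_mem x hx y hy hx1 hy1
      simpa using this
  have hfx : f '' A.cell x = A.cell x := by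
    rw [hcellx, Set.image_sdiff f.injective, hfQ, Set.image_singleton, hf.2]
  have e : A.cell (h * x) = A.cell h * A.cell x := by
    apply Set.Subset.antisymm
    · refine ((A.isASet_cell h).mul (A.isASet_cell x)).cell_subset ?_
      exact ⟨h, A.mem_cell_self h, x, A.mem_cell_self x, rfl⟩
    · rintro _ ⟨y, hy, z, hz, rfl⟩
      -- This product is an `A`-set containing `h`, hence all of `A.cell h`; so the coset `yQ` meets
      -- `A.cell (h * x)`, and `htr` fills in the rest of it outside `P`.
      have hmem : h ∈ A.cell (h * x) * (Q : Set H) :=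
        ⟨_, A.mem_cell_self _, x⁻¹, Q.inv_mem hx, by simp⟩
      obtain ⟨u, hu, w, hw', e⟩ := ((A.isASet_cell (h * x)).mul hQ).cell_subset hmem hy
      simp only at e
      have hyP : y ∈ P := IsASet.cell_subset hP hh hy
      have hu' : u = y * w⁻¹ := by rw [← e, mul_inv_cancel_right]
      have hw1 : w⁻¹ ≠ 1 := by
        intro h1
        rw [h1, mul_one] at hu'
        rw [hu'] at hu
        have hPm : h * x ∈ P := IsASet.cell_subset hP hyP (mem_cell_comm.1 hu)
        exact hx1 (hs.eq_one ((P.mul_mem_cancel_left hh).1 hPm) hx)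
      rw [hcellx] at hz
      have := htr y hyP w⁻¹ (Q.inv_mem hw') z hz.1 hw1 hz.2
      rwa [← hu', cell_eq_cell hu] at this
  rw [e, image_mul_of_mem_isoOne hf (A.isASet_cell h), hw.image_cell hf hfa hfb hfc hh, hfx]

end Assembly

end SRing

/-! ### Solvability of the affine group of a field -/

section Affine

/-- The group of affine permutations `x ↦ αx + β` of a field. -/
def affinePerm (F : Type*) [Field F] : Subgroup (Equiv.Perm F) where
  carrier := {π | ∃ α β, ∀ x, π x = α * x + β}
  one_mem' := ⟨1, 0, by simp⟩
  mul_mem' := by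
    rintro π σ ⟨α, β, h⟩ ⟨γ, δ, h'⟩
    exact ⟨α * γ, α * δ + β, fun x => by rw [Equiv.Perm.mul_apply, h, h']; ring⟩
  inv_mem' := by
    rintro π ⟨α, β, h⟩
    have hα : α ≠ 0 := by
      rintro rfl
      have : π 0 = π 1 := by rw [h, h]; ring
      exact zero_ne_one (π.injective this)
    refine ⟨α⁻¹, -(α⁻¹ * β), fun x => ?_⟩
    rw [Equiv.Perm.inv_eq_iff_eq, h]
    field_simp
    ring

/-- The linear part of an affine permutation. -/
def affinePermSlope (F : Type*) [Field F] : affinePerm F →* F where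
  toFun π := (π : Equiv.Perm F) 1 - (π : Equiv.Perm F) 0
  map_one' := by simp
  map_mul' := by
    rintro ⟨π, α, β, h⟩ ⟨σ, γ, δ, h'⟩
    simp only [Subgroup.coe_mul, Equiv.Perm.mul_apply, h, h']
    ring

/-- The kernel of the slope is the abelian group of translations, and the slopes lie in the abelian
group of units. -/
theorem isSolvable_affinePerm (F : Type*) [Field F] : Group.IsSolvable (affinePerm F) := by
  have hker : Group.IsSolvable (affinePermSlope F).toHomUnits.ker := by
    refine Group.isSolvable_of_comm ?_
    have key : ∀ π : (affinePermSlope F).toHomUnits.ker, ∃ β, ∀ x,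
        (π : affinePerm F).1 x = x + β := by
      rintro ⟨⟨π, α, β, h⟩, hk⟩
      have h1 : π 1 - π 0 = 1 := by
        have := congrArg Units.val (MonoidHom.mem_ker.1 hk)
        simpa [affinePermSlope] using this
      refine ⟨β, fun x => ?_⟩
      rw [h, h] at h1
      have : α = 1 := by linear_combination h1
      simp only [h, this, one_mul]
    intro π σ
    obtain ⟨β, h⟩ := key π
    obtain ⟨γ, h'⟩ := key σ
    refine Subtype.ext (Subtype.ext (Equiv.ext fun x => ?_))
    change (π : affinePerm F).1 ((σ : affinePerm F).1 x) =
      (σ : affinePerm F).1 ((π : affinePerm F).1 x)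
    simp only [h, h']
    ring
  exact Group.isSolvable_of_ker_le_range (affinePermSlope F).toHomUnits.ker.subtype
    (affinePermSlope F).toHomUnits (by simp)

end Affine

namespace SRing

/-! ### The non-solvable case: automorphisms preserving the cosets of `Q` -/

section Fibre

variable {G : Type*} [CommGroup G] [Finite G] {A : SRing G}

/-- The automorphisms of `A` that preserve every coset of a subgroup `Q`. -/
def autFibre (A : SRing G) (Q : Subgroup G) : Subgroup A.aut where
  carrier := {k | ∀ g : G, (k : Equiv.Perm G) g * g⁻¹ ∈ Q}
  one_mem' := by simp
  mul_mem' := by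
    intro k k' h h' g
    have := Q.mul_mem (h ((k' : Equiv.Perm G) g)) (h' g)
    simpa using this
  inv_mem' := by
    intro k h g
    have := Q.inv_mem (h ((k : Equiv.Perm G)⁻¹ g))
    simpa using this

theorem autFibre_normal {Q : Subgroup G} (hQ : A.IsASubgroup Q) : (A.autFibre Q).Normal where
  conj_mem := by
    intro r hr k g
    have h1 := hr ((k : Equiv.Perm G)⁻¹ g)
    have h2 := (mem_iff_of_mem_aut k.2 hQ _ _).1 h1
    simpa using h2

/-- As `k` preserves arcs of type `N * {v ^ j}`, each further application shifts by the same coset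
`N * {v ^ i}` as the first. -/
theorem pow_apply_mem_mul_singleton {N : Subgroup G} {v : G}
    (hcos : ∀ i : ℕ, A.IsASet ((N : Set G) * {v ^ i})) {k : Equiv.Perm G} (hk : k ∈ A.aut) {g : G}
    {i : ℕ} (h : k g * g⁻¹ ∈ (N : Set G) * {v ^ i}) (n : ℕ) :
    (k ^ n) g * g⁻¹ ∈ (N : Set G) * {v ^ (i * n)} := by
  induction n with
  | zero => exact ⟨1, N.one_mem, 1, by simp, by simp⟩
  | succ n ih =>
    have h2 := (mem_iff_of_mem_aut hk (hcos _) _ _).1 ih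
    have e : (N : Set G) * {v ^ (i * (n + 1))} = (N * {v ^ (i * n)}) * (N * {v ^ i}) := by
      rw [mul_mul_mul_comm, coe_mul_coe, Set.singleton_mul_singleton, ← pow_add, mul_add, mul_one]
    rw [e, pow_succ', Equiv.Perm.mul_apply]
    exact ⟨_, h2, _, h, by simp⟩

theorem pow_prime_apply_mem {p : ℕ} {N : Subgroup G} {v : G} (hN : A.IsASubgroup N)
    (hv : A.IsASet ((N : Set G) * {v})) (hvp : v ^ p = 1) {k : Equiv.Perm G} (hk : k ∈ A.aut)
    (h : ∀ g, k g * g⁻¹ ∈ N ⊔ Subgroup.zpowers v) (g : G) : (k ^ p) g * g⁻¹ ∈ N := by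
  have hcos : ∀ i : ℕ, A.IsASet ((N : Set G) * {v ^ i}) := fun i =>
    (isASet_coset_of_mem_sup_zpowers A.one_mem_isoOne hN (by simp) hv
      ⟨1, N.one_mem, v, rfl, by simp⟩
      (Subgroup.mem_sup_right (Subgroup.pow_mem _ (Subgroup.mem_zpowers v) i))).1
  obtain ⟨n, hn, z, hz, e⟩ := Subgroup.mem_sup.1 (h g)
  rw [← mem_powers_iff_mem_zpowers] at hz
  obtain ⟨i, rfl⟩ := hz
  have := pow_apply_mem_mul_singleton hcos hk (i := i) ⟨n, hn, v ^ i, rfl, e⟩ p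
  rw [mul_comm i, pow_mul, hvp, one_pow, Set.singleton_one, mul_one] at this
  exact this

end Fibre

section Nonsolvable

variable {p q : ℕ} {H : Type*} [CommGroup H] [Finite H]
  {P Q L M : Subgroup H} {a b c d : H} {A : SRing H}

/-- Each `p`-th power descends one step in the chain `H > QM > QL > Q`. -/
theorem pow_mem_autFibre [Fact p.Prime] (hs : IsCubePrimeSplit p q P Q d) (hw : IsWreathFlag A p P L M a b c)
    (hQ : A.IsASubgroup Q) (k : A.aut) : k ^ p ^ 3 ∈ A.autFibre Q := by
  have hcoe : ∀ N N' : Subgroup H, ((N ⊔ N' : Subgroup H) : Set H) = N * (N' : Set H) := fun N N' =>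
    Subgroup.mul_normal N N'
  have hQL : A.IsASubgroup (Q ⊔ L) := by
    rw [IsASubgroup, hcoe]
    exact hQ.mul hw.isASubgroup_left
  have hQM : A.IsASubgroup (Q ⊔ M) := by
    rw [IsASubgroup, hcoe]
    exact hQ.mul hw.isASubgroup_mid
  have hLM := hw.left_le
  have haP : a ∈ P := hw.mid_le (hLM hw.mem_left)
  have hbP : b ∈ P := hw.mid_le hw.mem_mid
  have h1 : ∀ g, (k.1 ^ p) g * g⁻¹ ∈ Q ⊔ M := by
    refine pow_prime_apply_mem hQM (v := c) ?_ (hs.pow_left c hw.mem_right) k.2 fun g => ?_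
    · rw [hcoe, mul_assoc, ← hw.cell_right c hw.mem_right hw.notMem_mid]
      exact hQ.mul (A.isASet_cell c)
    · rw [sup_assoc, hw.right_eq, sup_comm, hs.sup_eq]
      trivial
  have h2 : ∀ g, ((k.1 ^ p) ^ p) g * g⁻¹ ∈ Q ⊔ L := by
    refine pow_prime_apply_mem hQL (v := b) ?_ (hs.pow_left b hbP) (A.aut.pow_mem k.2 p)
      fun g => ?_
    · rw [hcoe, mul_assoc, ← hw.cell_mid b hw.mem_mid hw.notMem_left]
      exact hQ.mul (A.isASet_cell b)
    · rw [sup_assoc, hw.mid_eq]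
      exact h1 g
  have h3 : ∀ g, (((k.1 ^ p) ^ p) ^ p) g * g⁻¹ ∈ Q := by
    refine pow_prime_apply_mem hQ (v := a) ?_ (hs.pow_left a haP)
      (A.aut.pow_mem (A.aut.pow_mem k.2 p) p) fun g => ?_
    · rw [← hw.cell_left a hw.mem_left]
      exact hQ.mul (A.isASet_cell a)
    · rw [hw.left_eq]
      exact h2 g
  intro g
  have e : ((k ^ p ^ 3 : A.aut) : Equiv.Perm H) = ((k.1 ^ p) ^ p) ^ p := by
    rw [Subgroup.coe_pow, ← pow_mul, ← pow_mul]
    congr 1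
    ring
  rw [e]
  exact h3 g

theorem isSolvable_aut_of_isSolvable_autFibre [Fact p.Prime]
    (hs : IsCubePrimeSplit p q P Q d)
    (hw : IsWreathFlag A p P L M a b c) (hQ : A.IsASubgroup Q)
    (h : Group.IsSolvable (A.autFibre Q)) : Group.IsSolvable A.aut := by
  have := autFibre_normal hQ
  have hpg : IsPGroup p (A.aut ⧸ A.autFibre Q) := by
    intro x
    obtain ⟨k, rfl⟩ := QuotientGroup.mk_surjective x
    refine ⟨3, ?_⟩
    rw [← QuotientGroup.mk_pow, QuotientGroup.eq_one_iff]
    exact pow_mem_autFibre hs hw hQ k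
  have := hpg.isNilpotent
  exact (Group.isSolvable_iff_subgroup_quotient (A.autFibre Q)).2 ⟨h, inferInstance⟩

theorem isSolvable_inducedGroup {G : Type*} [Group G] {K : Subgroup (Equiv.Perm G)}
    (hK : Group.IsSolvable K) (U : Subgroup G) : Group.IsSolvable (inducedGroup K U) := by
  let S : Subgroup K :=
    { carrier := {k | ∀ x, (k : Equiv.Perm G) x ∈ U ↔ x ∈ U}
      one_mem' := by simp
      mul_mem' := by
        intro k k' h h' x
        rw [Subgroup.coe_mul, Equiv.Perm.mul_apply, h, h']
      inv_mem' := by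
        intro k h x
        rw [← h]
        simp }
  let φ : S →* Equiv.Perm U :=
    { toFun := fun k => (k : K).1.subtypePerm k.2
      map_one' := by ext; rfl
      map_mul' := fun _ _ => by ext; rfl }
  have hle : inducedGroup K U ≤ φ.range := by
    rintro s ⟨f, hf, hfs⟩
    have hmem : ∀ x, f x ∈ U ↔ x ∈ U := by
      intro x
      constructor
      · intro hx
        have h1 := hfs (s.symm ⟨f x, hx⟩)
        rw [Equiv.apply_symm_apply] at h1
        rw [← f.injective h1]
        exact Subtype.property _
      · intro hx
        rw [hfs ⟨x, hx⟩]
        exact Subtype.property _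
    refine ⟨⟨⟨f, hf⟩, hmem⟩, ?_⟩
    ext u
    exact hfs u
  have hr : Group.IsSolvable φ.range := Group.isSolvable_of_surjective φ.rangeRestrict_surjective
  exact Group.isSolvable_of_isSolvable_injective (Subgroup.inclusion_injective hle)

/-- Identify `Q` with the field of `q` elements. The orbit of `x` under the stabilizer of `1` is a
proper nonempty set of nonzero elements whose difference graph is preserved, so the action on `Q` is
affine, and it is faithful. -/
theorem isSolvable_autFibre_of_not_transitive [Fact q.Prime] (hs : IsCubePrimeSplit p q P Q d)
    (hP : A.IsASubgroup P) (hQ : A.IsASubgroup Q) {x y : H} (hx : x ∈ Q) (hy : y ∈ Q) (hx1 : x ≠ 1)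
    (hy1 : y ≠ 1) (hxy : ∀ k ∈ A.autFibre Q, k.1 1 = 1 → k.1 x ≠ y) :
    Group.IsSolvable (A.autFibre Q) := by
  classical
  have hQcard : Nat.card Q = q := by
    rw [← hs.zpowers_eq, Nat.card_zpowers]
    exact orderOf_eq_prime hs.pow_right hs.ne_one
  have hcyc : IsCyclic Q := isCyclic_of_prime_card hQcard
  let e : Multiplicative (ZMod q) ≃* Q := by
    have := zmodCyclicMulEquiv hcyc
    rwa [hQcard] at this
  let φ : ZMod q → H := fun i => (e (Multiplicative.ofAdd i) : H)
  have hφadd : ∀ i j, φ (i + j) = φ i * φ j := fun i j => by simp [φ, ofAdd_add]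
  have hφmem : ∀ i, φ i ∈ Q := fun i => Subtype.property _
  have hφ0 : φ 0 = 1 := by simp [φ]
  have hφinj : Function.Injective φ := fun i j h => by
    simpa using e.injective (Subtype.ext h)
  have hφsurj : ∀ z ∈ Q, ∃ i, φ i = z := fun z hz =>
    ⟨Multiplicative.toAdd (e.symm ⟨z, hz⟩), by simp [φ]⟩
  have hφsub : ∀ i j, φ (i - j) = φ i * (φ j)⁻¹ := fun i j => by
    rw [eq_mul_inv_iff_mul_eq, ← hφadd, sub_add_cancel]
  have hfib : ∀ k ∈ A.autFibre Q, ∀ z, k.1 z ∈ Q ↔ z ∈ Q := fun k hk z => by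
    have h := hk z
    constructor
    · intro h'
      have := Q.mul_mem (Q.inv_mem h) h'
      simpa using this
    · intro h'
      have := Q.mul_mem h h'
      simpa using this
  let ε : Q ≃ ZMod q := (e.symm.toEquiv).trans Multiplicative.toAdd
  have hε : ∀ u : Q, φ (ε u) = u := fun u => by simp [φ, ε]
  let ρ : A.autFibre Q →* Equiv.Perm (ZMod q) :=
    { toFun := fun k => ε.permCongrHom (k.1.1.subtypePerm (hfib k.1 k.2))
      map_one' := by
        rw [← map_one ε.permCongrHom]
        rfl
      map_mul' := fun k k' => by
        rw [← map_mul ε.permCongrHom]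
        rfl }
  have hρ : ∀ k i, φ (ρ k i) = k.1.1 (φ i) := fun k i => by
    change φ (ε _) = _
    rw [hε]
    rfl
  -- An element acting trivially on `Q` fixes `1`, so it preserves `P`; it also preserves each
  -- `Q`-coset, hence fixes `P` pointwise, and `k (h * z) = k h * k z` finishes.
  have hρinj : Function.Injective ρ := by
    rw [injective_iff_map_eq_one]
    intro k hk
    have hfix : ∀ z ∈ Q, k.1.1 z = z := fun z hz => by
      obtain ⟨i, rfl⟩ := hφsurj z hz
      rw [← hρ, hk]
      rfl
    have hk1 := hfix 1 Q.one_mem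
    refine Subtype.ext (Subtype.ext (Equiv.ext fun g => ?_))
    obtain ⟨h, hh, z, hz, rfl⟩ := hs.exists_mul_eq g
    have hkP := image_eq_of_mem_aut k.1.2 hk1 hP
    have hkQ := image_eq_of_mem_aut k.1.2 hk1 hQ
    have hkh : k.1.1 h = h := by
      have h1 : k.1.1 h * h⁻¹ ∈ P := P.mul_mem (apply_mem_of_image_eq hkP hh) (P.inv_mem hh)
      exact mul_inv_eq_one.1 (hs.eq_one h1 (k.2 h))
    rw [apply_mul_of_mem hs hP hQ (mem_isoOne_of_mem_aut k.1.2 hk1) hkP hkQ hh hz, hkh, hfix z hz]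
    rfl
  let O : Set H := {z | ∃ k ∈ A.autFibre Q, k.1 1 = 1 ∧ k.1 x = z}
  let S : Finset (ZMod q) := Finset.univ.filter fun i => φ i ∈ O
  have hS : ∀ i, i ∈ S ↔ φ i ∈ O := fun i => by simp [S]
  have hright : ∀ g ∈ Q, (⟨Equiv.mulRight g, rightMultiplications_le_aut A ⟨g, rfl⟩⟩ : A.aut) ∈
      A.autFibre Q := by
    intro g hg u
    simpa using hg
  -- Translating `k` to fix `1` stays within the group because translations by elements of `Q`
  -- preserve every `Q`-coset.
  have hOstep : ∀ k ∈ A.autFibre Q, ∀ g ∈ Q, ∀ z ∈ O, k.1 (z * g) * (k.1 g)⁻¹ ∈ O := by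
    rintro k hk g hg _ ⟨k', hk', hk'1, rfl⟩
    refine ⟨⟨Equiv.mulRight (k.1 g)⁻¹, rightMultiplications_le_aut A ⟨_, rfl⟩⟩ * k *
      ⟨Equiv.mulRight g, rightMultiplications_le_aut A ⟨g, rfl⟩⟩ * k',
      mul_mem (mul_mem (mul_mem (hright _ (Q.inv_mem ((hfib k hk g).2 hg))) hk) (hright g hg)) hk',
      ?_, ?_⟩
    · simp [hk'1]
    · simp
  have hrange : ρ.range ≤ affinePerm (ZMod q) := by
    rintro _ ⟨k, rfl⟩
    refine exists_affine_of_image_sub_eq (S := S) ?_ ?_ ?_ (ρ k).injective fun i => ?_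
    · rw [hS, hφ0]
      rintro ⟨k, -, hk1, hkx⟩
      exact hx1 (k.1.injective (hkx.trans hk1.symm))
    · obtain ⟨i, hi⟩ := hφsurj x hx
      exact ⟨i, (hS i).2 ⟨1, one_mem _, rfl, hi.symm⟩⟩
    · obtain ⟨i, hi⟩ := hφsurj y hy
      refine ⟨i, ?_, ?_⟩
      · rintro rfl
        exact hy1 (hi.symm.trans hφ0)
      · rw [hS, hi]
        rintro ⟨k, hk, hk1, hkx⟩
        exact hxy k hk hk1 hkx
    · refine Finset.eq_of_subset_of_card_le ?_ ?_
      · intro j hj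
        obtain ⟨s, hs', rfl⟩ := Finset.mem_image.1 hj
        rw [hS] at hs' ⊢
        rw [hφsub, hρ, hρ, add_comm, hφadd]
        exact hOstep k.1 k.2 _ (hφmem i) _ hs'
      · refine (Finset.card_image_of_injective _ fun s t hst => ?_).ge
        exact add_left_cancel ((ρ k).injective (sub_left_injective hst))
  have h1 := isSolvable_affinePerm (ZMod q)
  have h2 : Group.IsSolvable ρ.range :=
    Group.isSolvable_of_isSolvable_injective (Subgroup.inclusion_injective hrange)
  exact Group.isSolvable_of_isSolvable_injective (f := ρ.rangeRestrict)
    ((MonoidHom.rangeRestrict_injective_iff (f := ρ)).2 hρinj)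

/-- Non-solvability yields an automorphism fixing `1`, preserving each `Q`-coset and taking `x` to
`y`; it must fix `h`, since `P` meets `hQ` only in `h`. -/
theorem mul_mem_cell_of_not_isSolvable [Fact p.Prime] [Fact q.Prime]
    (hs : IsCubePrimeSplit p q P Q d)
    (hw : IsWreathFlag A p P L M a b c) (hQ : A.IsASubgroup Q)
    (hns : ¬ Group.IsSolvable (inducedGroup A.aut Q)) {h x y : H} (hh : h ∈ P) (hx : x ∈ Q)
    (hy : y ∈ Q) (hx1 : x ≠ 1) (hy1 : y ≠ 1) : h * y ∈ A.cell (h * x) := by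
  have hP := hw.isASubgroup_right
  by_contra hcon
  refine hns (isSolvable_inducedGroup (isSolvable_aut_of_isSolvable_autFibre hs hw hQ
    (isSolvable_autFibre_of_not_transitive hs hP hQ hx hy hx1 hy1 ?_)) Q)
  rintro k hk hk1 rfl
  apply hcon
  have hkP := image_eq_of_mem_aut k.2 hk1 hP
  have hkQ := image_eq_of_mem_aut k.2 hk1 hQ
  have hkh : k.1 h = h := by
    have h1 : k.1 h * h⁻¹ ∈ P := P.mul_mem (apply_mem_of_image_eq hkP hh) (P.inv_mem hh)
    exact mul_inv_eq_one.1 (hs.eq_one h1 (hk h))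
  have := apply_mem_cell_of_mem_aut k.2 hk1 (h * x)
  rwa [apply_mul_of_mem hs hP hQ (mem_isoOne_of_mem_aut k.2 hk1) hkP hkQ hh hx, hkh] at this

end Nonsolvable

end SRing

/-! ### The decomposable case: automorphisms fixing `Q` pointwise -/

theorem Subgroup.sup_zpowers_eq_of_card {G : Type*} [CommGroup G] [Finite G] {p i : ℕ}
    [Fact p.Prime] {N N' : Subgroup G} (hN : Nat.card N = p ^ i) (hN' : Nat.card N' = p ^ (i + 1))
    (hle : N ≤ N') {v : G} (hv : v ∈ N') (hvN : v ∉ N) : N ⊔ Subgroup.zpowers v = N' := by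
  have hle' : N ⊔ Subgroup.zpowers v ≤ N' := sup_le hle ((Subgroup.zpowers_le).2 hv)
  have h1 : Nat.card N ∣ Nat.card (N ⊔ Subgroup.zpowers v : Subgroup G) :=
    Subgroup.card_dvd_of_le le_sup_left
  have h2 := Subgroup.card_dvd_of_le hle'
  rw [hN', Nat.dvd_prime_pow Fact.out] at h2
  obtain ⟨j, hj, hcard⟩ := h2
  rw [hN, hcard, Nat.pow_dvd_pow_iff_le_right (Fact.out : p.Prime).one_lt] at h1
  have hji : j ≠ i := by
    rintro rfl
    have : N = N ⊔ Subgroup.zpowers v :=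
      Subgroup.eq_of_le_of_card_ge le_sup_left (by rw [hcard, hN])
    rw [this] at hvN
    exact hvN (Subgroup.mem_sup_right (Subgroup.mem_zpowers v))
  refine Subgroup.eq_of_le_of_card_ge hle' ?_
  rw [hcard, hN']
  exact Nat.pow_le_pow_right (Fact.out : p.Prime).pos (by omega)

theorem Subgroup.coe_mul_eq_self_iff {G : Type*} [Group G] {N : Subgroup G} {X : Set G} :
    (N : Set G) * X = X ↔ ∀ n ∈ N, ∀ x ∈ X, n * x ∈ X := by
  constructor
  · intro h n hn x hx
    rw [← h]
    exact Set.mul_mem_mul hn hx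
  · intro h
    apply Set.Subset.antisymm
    · rintro _ ⟨n, hn, x, hx, rfl⟩
      exact h n hn x hx
    · intro x hx
      exact ⟨1, N.one_mem, x, hx, one_mul x⟩

namespace SRing

section Pointwise

variable {G : Type*} [CommGroup G] [Finite G] {A : SRing G}

/-- The automorphisms of `A` that fix every element of a subgroup `Q`. -/
def autPointwise (A : SRing G) (Q : Subgroup G) : Subgroup (Equiv.Perm G) where
  carrier := {k | k ∈ A.aut ∧ ∀ x ∈ Q, k x = x}
  one_mem' := ⟨A.aut.one_mem, fun _ _ => rfl⟩
  mul_mem' := by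
    rintro k k' ⟨hk, h⟩ ⟨hk', h'⟩
    exact ⟨A.aut.mul_mem hk hk', fun x hx => by rw [Equiv.Perm.mul_apply, h' x hx, h x hx]⟩
  inv_mem' := by
    rintro k ⟨hk, h⟩
    exact ⟨A.aut.inv_mem hk, fun x hx => by rw [Equiv.Perm.inv_eq_iff_eq, h x hx]⟩

theorem apply_one_of_mem_autPointwise {Q : Subgroup G} {k : Equiv.Perm G}
    (hk : k ∈ A.autPointwise Q) : k 1 = 1 :=
  hk.2 1 Q.one_mem

theorem conj_mem_autPointwise {Q : Subgroup G} (hQ : A.IsASubgroup Q) {k n : Equiv.Perm G}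
    (hk : k ∈ A.aut) (hk1 : k 1 = 1) (hn : n ∈ A.autPointwise Q) :
    k * n * k⁻¹ ∈ A.autPointwise Q := by
  refine ⟨A.aut.mul_mem (A.aut.mul_mem hk hn.1) (A.aut.inv_mem hk), fun x hx => ?_⟩
  have h1 : k⁻¹ 1 = 1 := by rw [Equiv.Perm.inv_eq_iff_eq, hk1]
  have hx' : k⁻¹ x ∈ Q := apply_mem_of_image_eq (image_eq_of_mem_aut (A.aut.inv_mem hk) h1 hQ) hx
  rw [Equiv.Perm.mul_apply, Equiv.Perm.mul_apply, hn.2 _ hx']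
  simp

theorem conj_mulRight_mem_aut {k : Equiv.Perm G} (hk : k ∈ A.aut) (g h : G) :
    Equiv.mulRight h * k * Equiv.mulRight g ∈ A.aut :=
  A.aut.mul_mem (A.aut.mul_mem (rightMultiplications_le_aut A ⟨_, rfl⟩) hk)
    (rightMultiplications_le_aut A ⟨_, rfl⟩)

theorem mul_cell_eq_of_mul_cell_pow_eq {N : Subgroup G} {m : ℕ} (hm : (Nat.card G).Coprime m)
    {g : G} (h : (N : Set G) * A.cell (g ^ m) = A.cell (g ^ m)) :
    (N : Set G) * A.cell g = A.cell g := by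
  rw [Subgroup.coe_mul_eq_self_iff] at h ⊢
  intro n hn x hx
  have h1 := h (n ^ m) (N.pow_mem hn m) (x ^ m) (pow_mem_cell_pow hm hx)
  rw [← image_pow_cell hm, ← mul_pow] at h1
  obtain ⟨y, hy, e⟩ := h1
  rwa [← (Nat.Coprime.pow_left_bijective hm).1 e]

end Pointwise

section Decomposable

variable {p q : ℕ} {H : Type*} [CommGroup H] [Finite H]
  {P Q L M : Subgroup H} {a b c d : H} {A : SRing H}

theorem apply_mul_of_mem_aut (hs : IsCubePrimeSplit p q P Q d) (hP : A.IsASubgroup P)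
    (hQ : A.IsASubgroup Q) {k : Equiv.Perm H} (hk : k ∈ A.aut) (hk1 : k 1 = 1) {h x : H}
    (hh : h ∈ P) (hx : x ∈ Q) : k (h * x) = k h * k x :=
  apply_mul_of_mem hs hP hQ (mem_isoOne_of_mem_aut hk hk1) (image_eq_of_mem_aut hk hk1 hP)
    (image_eq_of_mem_aut hk hk1 hQ) hh hx

/-- An element of `Q` stays in its `P`-coset and in `Q`, which meet in one point. With the converse
below, the stabilizer of `1` in the coset kernel is exactly `A.autPointwise Q`. -/
theorem mem_autPointwise_of_mem_cosetKernel (hs : IsCubePrimeSplit p q P Q d)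
    (hQ : A.IsASubgroup Q) {k : Equiv.Perm H} (hk : k ∈ cosetKernel A.aut P) (hk1 : k 1 = 1) :
    k ∈ A.autPointwise Q := by
  refine ⟨hk.1, fun x hx => ?_⟩
  have h1 : k x ∈ Q := apply_mem_of_image_eq (image_eq_of_mem_aut hk.1 hk1 hQ) hx
  have h2 : k x ∈ MulOpposite.op x • (P : Set H) :=
    apply_mem_of_image_eq (hk.2 x) ⟨1, P.one_mem, by simp⟩
  obtain ⟨h, hh, e⟩ := h2
  have e' : h * x = k x := e
  have h3 : h = 1 := by
    refine hs.eq_one hh ?_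
    have := Q.mul_mem h1 (Q.inv_mem hx)
    rwa [← e', mul_inv_cancel_right] at this
  rw [← e', h3, one_mul]

theorem mem_cosetKernel_of_mem_autPointwise (hs : IsCubePrimeSplit p q P Q d)
    (hP : A.IsASubgroup P) (hQ : A.IsASubgroup Q) {k : Equiv.Perm H}
    (hk : k ∈ A.autPointwise Q) : k ∈ cosetKernel A.aut P := by
  have hk1 := apply_one_of_mem_autPointwise hk
  have hkP := image_eq_of_mem_aut hk.1 hk1 hP
  refine ⟨hk.1, fun g => ?_⟩
  refine Set.eq_of_subset_of_ncard_le ?_ (Set.ncard_image_of_injective _ k.injective).ge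
  rintro _ ⟨_, ⟨h, hh, rfl⟩, rfl⟩
  obtain ⟨h', hh', x, hx, rfl⟩ := hs.exists_mul_eq g
  change k (h * (h' * x)) ∈ _
  rw [← mul_assoc, apply_mul_of_mem_aut hs hP hQ hk.1 hk1 (P.mul_mem hh hh') hx, hk.2 x hx]
  refine ⟨k (h * h') * h'⁻¹, P.mul_mem (apply_mem_of_image_eq hkP (P.mul_mem hh hh'))
    (P.inv_mem hh'), ?_⟩
  change k (h * h') * h'⁻¹ * (h' * x) = _
  group

/-- Decomposability restated through orbits of `A.autPointwise Q` on `P`: `V` is invariant, and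
outside `U` every shift by an element of `V` is realized. -/
theorem exists_subgroups_of_isDecomposable (hs : IsCubePrimeSplit p q P Q d)
    (hP : A.IsASubgroup P) (hQ : A.IsASubgroup Q)
    {hK : rightMultiplications P ≤ inducedGroup (cosetKernel A.aut P) P}
    (hdec : (transitivityModule (inducedGroup (cosetKernel A.aut P) P) hK).IsDecomposable) :
    ∃ U V : Subgroup H, U ≤ P ∧ U ≠ P ∧ V ≤ P ∧ V ≠ ⊥ ∧
      (∀ k ∈ A.autPointwise Q, ∀ l ∈ V, k l ∈ V) ∧
      ∀ g ∈ P, g ∉ U → ∀ l ∈ V, ∃ k ∈ A.autPointwise Q, k g = l * g := by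
  set B := transitivityModule (inducedGroup (cosetKernel A.aut P) P) hK with hB
  obtain ⟨U, V, ⟨-, hV, -, -, hrad⟩, hVbot, hUtop⟩ := hdec
  have hcell : ∀ u, B.cell u =
      MulAction.orbit (MulAction.stabilizer (inducedGroup (cosetKernel A.aut P) P) (1 : P)) u :=
    fun u => cell_eq_of_mem (A := B) ⟨u, rfl⟩ (MulAction.mem_orbit_self u)
  refine ⟨U.map P.subtype, V.map P.subtype, Subgroup.map_subtype_le U, ?_,
    Subgroup.map_subtype_le V, ?_, ?_, ?_⟩
  · intro h
    apply hUtop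
    rw [eq_top_iff]
    intro u _
    have : (u : H) ∈ U.map P.subtype := by
      rw [h]
      exact u.2
    exact (Subgroup.mem_map_iff_mem P.subtype_injective).1 this
  · rwa [Ne, Subgroup.map_eq_bot_iff_of_injective _ P.subtype_injective]
  · rintro k hk _ ⟨l, hl, rfl⟩
    have hk1 := apply_one_of_mem_autPointwise hk
    have hkP : ∀ u, k u ∈ P ↔ u ∈ P := by
      intro u
      rw [← SetLike.mem_coe]
      conv_lhs => rw [← image_eq_of_mem_aut hk.1 hk1 hP]
      exact k.injective.mem_set_image
    let s : Equiv.Perm P := k.subtypePerm hkP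
    have hsmem : s ∈ inducedGroup (cosetKernel A.aut P) P :=
      ⟨k, mem_cosetKernel_of_mem_autPointwise hs hP hQ hk, fun _ => rfl⟩
    have hs1 : (⟨s, hsmem⟩ : inducedGroup (cosetKernel A.aut P) P) ∈
        MulAction.stabilizer (inducedGroup (cosetKernel A.aut P) P) (1 : P) :=
      Subtype.ext hk1
    have : s l ∈ B.cell l := by
      rw [hcell]
      exact ⟨⟨_, hs1⟩, rfl⟩
    exact ⟨s l, IsASet.cell_subset hV hl this, rfl⟩
  · rintro g hg hgU _ ⟨l, hl, rfl⟩
    have hgU' : (⟨g, hg⟩ : P) ∉ U := fun h => hgU ⟨_, h, rfl⟩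
    have h1 := hrad _ (B.cell_mem_basicSets ⟨g, hg⟩) (fun h => hgU' (h (B.mem_cell_self _))) hl
    have h2 : l * ⟨g, hg⟩ ∈ B.cell ⟨g, hg⟩ := by
      have h3 := Set.smul_mem_smul_set (a := l) (B.mem_cell_self ⟨g, hg⟩)
      rwa [h1.1] at h3
    rw [hcell] at h2
    obtain ⟨⟨⟨s, k, hk, hks⟩, hs1⟩, e⟩ := h2
    have hs1' : s 1 = 1 := hs1
    have e' : s ⟨g, hg⟩ = l * ⟨g, hg⟩ := e
    refine ⟨k, mem_autPointwise_of_mem_cosetKernel hs hQ hk ?_, ?_⟩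
    · have := hks 1
      rwa [hs1'] at this
    · have := hks ⟨g, hg⟩
      rwa [e'] at this

theorem exists_pow_eq_mul [Fact p.Prime] {N : Subgroup H} {v h : H}
    (hexp : ∀ y ∈ N ⊔ Subgroup.zpowers v, y ^ p = 1)
    (hh : h ∈ N ⊔ Subgroup.zpowers v) (hN : h ∉ N) : ∃ y ∈ N, ∃ i : ℕ, ¬ p ∣ i ∧ h ^ i = y * v := by
  obtain ⟨y, hy, i, hi, rfl⟩ := exists_pow_mul_eq hexp hh hN
  obtain ⟨j, -, hj⟩ := Nat.exists_mul_mod_eq_one_of_coprime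
    (((Fact.out : p.Prime).coprime_iff_not_dvd.2 hi).symm) (Fact.out : p.Prime).one_lt
  have hpj : ¬ p ∣ j := by
    intro h
    rw [Nat.mod_eq_zero_of_dvd (h.mul_left i)] at hj
    exact zero_ne_one hj
  have hyv : (y * v) ^ p = 1 :=
    hexp _ (mul_mem (Subgroup.mem_sup_left hy) (Subgroup.mem_sup_right (Subgroup.mem_zpowers v)))
  refine ⟨y, hy, j, hpj, ?_⟩
  rw [← pow_mul, ← Nat.div_add_mod (i * j) p, hj, pow_add, pow_mul, hyv, one_pow, one_mul, pow_one]

variable [Fact p.Prime] [Fact q.Prime]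

/-- Invariance under `N` of the basic set of `gd` spreads from one `g ∈ P \ M` to all of them. -/
theorem mul_cell_eq_of_exists (hA : A.IsSchurian) (hs : IsCubePrimeSplit p q P Q d)
    (hw : IsWreathFlag A p P L M a b c) (hQ : A.IsASubgroup Q) {N : Subgroup H} {g v : H}
    (hg : g ∈ P) (hgM : g ∉ M) (hv : v ∈ P) (hvM : v ∉ M)
    (h : (N : Set H) * A.cell (g * d) = A.cell (g * d)) :
    (N : Set H) * A.cell (v * d) = A.cell (v * d) := by
  have hP := hw.isASubgroup_right
  have hsup : M ⊔ Subgroup.zpowers g = P :=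
    Subgroup.sup_zpowers_eq_of_card hw.card_mid hw.card_right hw.mid_le hg hgM
  obtain ⟨y, hy, i, hi, e⟩ := exists_pow_eq_mul (p := p) (N := M) (v := g) (h := v)
    (fun z hz => hs.pow_left z (hsup ▸ hz)) (hsup.symm ▸ hv) hvM
  obtain ⟨m, hm, hmP, hmd⟩ := hs.exists_multiplier hi hs.mem_right hs.ne_one
  refine mul_cell_eq_of_mul_cell_pow_eq hm ?_
  rw [mul_pow, hmP v hv, e, hmd]
  have hyg : y * g ∈ A.cell g := by
    rw [hw.cell_right g hg hgM]
    exact ⟨y, hy, g, rfl, rfl⟩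
  -- Since `y * g` lies in the basic set `Mg`, schurity gives an automorphism taking `g` to `y * g`.
  -- It may move `d` within `Q \ {1}`, which a multiplier trivial on `P` repairs.
  obtain ⟨k, hk, hk1, hkg⟩ := exists_aut_of_mem_cell hA hyg
  have hkd : k d ∈ Q := apply_mem_of_image_eq (image_eq_of_mem_aut hk hk1 hQ) hs.mem_right
  have hkd1 : k d ≠ 1 := fun h => hs.ne_one (k.injective (h.trans hk1.symm))
  obtain ⟨n, hn, hnP, hnd⟩ := hs.exists_multiplier (i := 1)
    (fun h => (Fact.out : p.Prime).one_lt.ne' (Nat.dvd_one.1 h)) hkd hkd1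
  refine mul_cell_eq_of_mul_cell_pow_eq hn ?_
  rw [mul_pow, hnP _ (P.mul_mem (hw.mid_le hy) hg), pow_one, hnd, ← hkg,
    ← apply_mul_of_mem_aut hs hP hQ hk hk1 hg hs.mem_right,
    cell_eq_cell (apply_mem_cell_of_mem_aut hk hk1 (g * d))]
  exact h

/-- Since `{l}` is a basic set, translation by `l` permutes the basic sets; it fixes this one, and
`l` generates `L`, which has prime order. -/
theorem mul_cell_eq_of_mul_mem (hw : IsWreathFlag A p P L M a b c) {l g : H} (hl : l ∈ L)
    (hl1 : l ≠ 1) (h : l * g ∈ A.cell g) : (L : Set H) * A.cell g = A.cell g := by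
  have hlA : A.IsASet {l} := hw.cell_left l hl ▸ A.isASet_cell l
  have e : A.cell g = {l} * A.cell g := by
    refine Set.eq_of_subset_of_ncard_le ?_ ?_
    · have := (hlA.mul (A.isASet_cell g)).cell_subset
        (show l * g ∈ _ from ⟨l, rfl, g, A.mem_cell_self g, rfl⟩)
      rwa [cell_eq_cell h] at this
    · rw [Set.singleton_mul, Set.ncard_image_of_injective _ (mul_right_injective l)]
  have hgen : L = Subgroup.zpowers l := by
    have := Subgroup.sup_zpowers_eq_of_card (p := p) (i := 0) (N := ⊥) (N' := L) (v := l)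
      (by simp) (by simpa using hw.card_left) bot_le hl (by simpa using hl1)
    rw [← this, bot_sup_eq]
  rw [Subgroup.coe_mul_eq_self_iff]
  intro n hn x hx
  rw [hgen, ← mem_powers_iff_mem_zpowers] at hn
  obtain ⟨i, rfl⟩ := hn
  induction i with
  | zero => simpa using hx
  | succ i ih =>
    rw [e]
    exact ⟨l, rfl, _, ih, by simp only [pow_succ']; rw [mul_assoc]⟩

/-- If invariance fails, automorphisms fixing `Q` pointwise cannot move a point of `P \ M` by a
nontrivial element of `L`. This forces `V` to be a complement of `L` in `M`, and comparing shifts by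
`l ∈ V` with an automorphism taking `l` to `a * l` produces the forbidden shift by `a`. -/
theorem mul_cell_eq_of_isDecomposable (hA : A.IsSchurian) (hs : IsCubePrimeSplit p q P Q d)
    (hw : IsWreathFlag A p P L M a b c) (hQ : A.IsASubgroup Q)
    {hK : rightMultiplications P ≤ inducedGroup (cosetKernel A.aut P) P}
    (hdec : (transitivityModule (inducedGroup (cosetKernel A.aut P) P) hK).IsDecomposable)
    {v : H} (hv : v ∈ P) (hvM : v ∉ M) : (L : Set H) * A.cell (v * d) = A.cell (v * d) := by
  by_contra hcon
  have hP := hw.isASubgroup_right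
  obtain ⟨U, V, hUP, hUne, hVP, hVbot, hVinv, hVU⟩ :=
    exists_subgroups_of_isDecomposable hs hP hQ hdec
  have hno : ∀ g ∈ P, g ∉ M → ∀ k ∈ A.autPointwise Q, ∀ l ∈ L, k g = l * g → l = 1 := by
    intro g hg hgM k hk l hl e
    by_contra hl1
    refine hcon (mul_cell_eq_of_exists hA hs hw hQ hg hgM hv hvM
      (mul_cell_eq_of_mul_mem hw hl hl1 ?_))
    have hk1 := apply_one_of_mem_autPointwise hk
    have h1 := apply_mem_cell_of_mem_aut hk.1 hk1 (g * d)
    rwa [apply_mul_of_mem_aut hs hP hQ hk.1 hk1 hg hs.mem_right, e, hk.2 d hs.mem_right,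
      mul_assoc] at h1
  -- `P` is not the union of the proper subgroups `M` and `U`.
  obtain ⟨g₁, hg₁, hg₁M, hg₁U⟩ : ∃ g ∈ P, g ∉ M ∧ g ∉ U := by
    by_cases hcU : c ∈ U
    · obtain ⟨u, hu, huU⟩ := SetLike.exists_of_lt (lt_of_le_of_ne hUP hUne)
      by_cases huM : u ∈ M
      · exact ⟨c * u, P.mul_mem hw.mem_right hu,
          fun h => hw.notMem_mid ((M.mul_mem_cancel_right huM).1 h),
          fun h => huU ((U.mul_mem_cancel_left hcU).1 h)⟩
      · exact ⟨u, hu, huM, huU⟩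
    · exact ⟨c, hw.mem_right, hw.notMem_mid, hcU⟩
  have hVM : V ≤ M := by
    intro l hl
    obtain ⟨k, hk, e⟩ := hVU g₁ hg₁ hg₁U l hl
    have h1 := apply_mem_cell_of_mem_aut hk.1 (apply_one_of_mem_autPointwise hk) g₁
    rw [e, hw.cell_right g₁ hg₁ hg₁M] at h1
    obtain ⟨y, hy, z, hz, e'⟩ := h1
    rw [Set.mem_singleton_iff.1 hz] at e'
    rwa [← mul_right_cancel e']
  have hVL : ∀ l ∈ V, l ∈ L → l = 1 := by
    intro l hl hlL
    obtain ⟨k, hk, e⟩ := hVU g₁ hg₁ hg₁U l hl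
    exact hno g₁ hg₁ hg₁M k hk l hlL e
  obtain ⟨⟨l, hl⟩, hl1⟩ := Subgroup.ne_bot_iff_exists_ne_one.1 hVbot
  have hl1 : l ≠ 1 := fun h => hl1 (Subtype.ext h)
  have hlM := hVM hl
  have hlL : l ∉ L := fun h => hl1 (hVL l hl h)
  have hlP := hw.mid_le hlM
  -- `k l` lies in `Ll` and in `V`, and `L` meets `V` trivially.
  have hkl : ∀ k ∈ A.autPointwise Q, k l = l := by
    intro k hk
    have h1 := apply_mem_cell_of_mem_aut hk.1 (apply_one_of_mem_autPointwise hk) l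
    rw [hw.cell_mid l hlM hlL] at h1
    obtain ⟨y, hy, z, hz, e⟩ := h1
    rw [Set.mem_singleton_iff.1 hz] at e
    simp only at e
    have hyV : y ∈ V := by
      rw [eq_mul_inv_of_mul_eq e]
      exact V.mul_mem (hVinv k hk l hl) (V.inv_mem hl)
    rw [← e, hVL y hyV hy, one_mul]
  -- The translate `z ↦ k (z * x) * (k x)⁻¹` agrees with `k` on `Q`, so the two differ by an element
  -- of `A.autPointwise Q`, which fixes `l`.
  have hmulP : ∀ k ∈ A.aut, k 1 = 1 → ∀ x ∈ P, k (l * x) = k l * k x := by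
    intro k hk hk1 x hx
    have hmem := conj_mulRight_mem_aut hk x (k x)⁻¹
    have hpt : k⁻¹ * (Equiv.mulRight (k x)⁻¹ * k * Equiv.mulRight x) ∈ A.autPointwise Q := by
      refine ⟨A.aut.mul_mem (A.aut.inv_mem hk) hmem, fun z hz => ?_⟩
      rw [Equiv.Perm.mul_apply, Equiv.Perm.inv_eq_iff_eq]
      change k (z * x) * (k x)⁻¹ = k z
      rw [mul_comm z, apply_mul_of_mem_aut hs hP hQ hk hk1 hx hz, mul_comm (k x),
        mul_inv_cancel_right]
    have h2 := hkl _ hpt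
    rw [Equiv.Perm.mul_apply, Equiv.Perm.inv_eq_iff_eq] at h2
    change k (l * x) * (k x)⁻¹ = k l at h2
    rw [← h2, inv_mul_cancel_right]
  have hfixM : ∀ k ∈ A.autPointwise Q, ∀ y ∈ M, k y = y := by
    intro k hk y hy
    have hk1 := apply_one_of_mem_autPointwise hk
    rw [← Subgroup.sup_zpowers_eq_of_card (p := p) (i := 1) (by rw [hw.card_left, pow_one])
      hw.card_mid hw.left_le hlM hlL] at hy
    obtain ⟨n, hn, z, hz, rfl⟩ := Subgroup.mem_sup.1 hy
    rw [← mem_powers_iff_mem_zpowers] at hz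
    obtain ⟨i, rfl⟩ := hz
    have hi : ∀ i : ℕ, k (l ^ i) = l ^ i := by
      intro i
      induction i with
      | zero => simpa using hk1
      | succ i ih =>
        rw [pow_succ', hmulP k hk.1 hk1 _ (P.pow_mem hlP i), ih, hkl k hk]
    have hnA : A.IsASet {n} := hw.cell_left n hn ▸ A.isASet_cell n
    have h3 := (mem_iff_of_mem_aut hk.1 hnA (l ^ i) (n * l ^ i)).1 (by simp)
    rw [hi, Set.mem_singleton_iff, mul_inv_eq_iff_eq_mul] at h3
    exact h3
  -- A point of `M` outside `U` would be moved by a shift by `l`, contrary to `hfixM`.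
  have hMU : M ≤ U := by
    intro y hy
    by_contra hyU
    obtain ⟨k, hk, e⟩ := hVU y (hw.mid_le hy) hyU l hl
    rw [hfixM k hk y hy] at e
    exact hl1 (right_eq_mul.1 e)
  have hnotU : ∀ g ∈ P, g ∉ M → g ∉ U := by
    intro g hg hgM hgU
    refine hUne (le_antisymm hUP ?_)
    rw [← Subgroup.sup_zpowers_eq_of_card hw.card_mid hw.card_right hw.mid_le hg hgM]
    exact sup_le hMU ((Subgroup.zpowers_le).2 hgU)
  have hal : a * l ∈ A.cell l := by
    rw [hw.cell_mid l hlM hlL]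
    exact ⟨a, hw.mem_left, l, rfl, rfl⟩
  obtain ⟨k, hk, hk1, hkl'⟩ := exists_aut_of_mem_cell hA hal
  obtain ⟨n, hn, hnc⟩ := hVU c hw.mem_right (hnotU c hw.mem_right hw.notMem_mid) l hl
  have hkcP : k c ∈ P := apply_mem_of_image_eq (image_eq_of_mem_aut hk hk1 hP) hw.mem_right
  have hkcM : k c ∉ M := by
    intro h
    have := IsASet.cell_subset hw.isASubgroup_mid h
      (mem_cell_comm.1 (apply_mem_cell_of_mem_aut hk hk1 c))
    exact hw.notMem_mid this
  obtain ⟨n', hn', hn'c⟩ := hVU (k c) hkcP (hnotU _ hkcP hkcM) l hl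
  have hlkc : l * k c ∉ M := fun h => hkcM ((M.mul_mem_cancel_left hlM).1 h)
  have hinv : ∀ (σ : Equiv.Perm H) (x : H), σ⁻¹ (σ x) = x := fun σ x => σ.symm_apply_apply x
  -- Followed from right to left, the product takes `l * k c` to `k c`, then `c`, then `l * c`, and
  -- finally `k l * k c = a * (l * k c)`.
  have ha1 : a = 1 := by
    refine hno (l * k c) (P.mul_mem hlP hkcP) hlkc (k * n * k⁻¹ * n'⁻¹)
      (mul_mem (conj_mem_autPointwise hQ hk hk1 hn) (Subgroup.inv_mem _ hn')) a hw.mem_left ?_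
    rw [← hn'c, Equiv.Perm.mul_apply, hinv, Equiv.Perm.mul_apply,
      Equiv.Perm.mul_apply, hinv, hnc, hmulP k hk hk1 c hw.mem_right, hkl',
      hn'c, mul_assoc]
  have hcard := hw.card_left
  rw [← hw.left_eq, ha1, Nat.card_zpowers, orderOf_one] at hcard
  exact (Fact.out : p.Prime).one_lt.ne hcard

end Decomposable

end SRing

/-! ### Sylow subgroups and the conclusion -/

theorem isCubePrimeSplit_of_sylow {p q : ℕ} [Fact p.Prime] [Fact q.Prime] (hpq : p ≠ q)
    {H : Type*} [CommGroup H] [Finite H]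
    (hH : Nonempty (H ≃* (Cyc p × Cyc p × Cyc p) × Cyc q)) (P : Sylow p H) (Q : Sylow q H) {d : H}
    (hd : Subgroup.zpowers d = (Q : Subgroup H)) :
    IsCubePrimeSplit p q (P : Subgroup H) (Q : Subgroup H) d := by
  have hp : p.Prime := Fact.out
  have hq : q.Prime := Fact.out
  obtain ⟨e⟩ := hH
  have hcard : Nat.card H = p ^ 3 * q := by
    rw [Nat.card_congr e.toEquiv, Nat.card_prod, Nat.card_prod, Nat.card_prod,
      SRing.natCard_cyc, SRing.natCard_cyc]
    ring
  have hcop : Nat.Coprime p q := (Nat.coprime_primes hp hq).2 hpq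
  have hcardP : Nat.card P = p ^ 3 := by
    rw [P.card_eq_multiplicity, hcard, Nat.factorization_mul (pow_ne_zero 3 hp.ne_zero) hq.ne_zero,
      hp.factorization_pow, hq.factorization]
    simp [hpq.symm]
  have hcardQ : Nat.card Q = q := by
    rw [Q.card_eq_multiplicity, hcard, Nat.factorization_mul (pow_ne_zero 3 hp.ne_zero) hq.ne_zero,
      hp.factorization_pow, hq.factorization]
    simp [hpq]
  have hcop3 : Nat.Coprime (p ^ 3) q := hcop.pow_left 3
  have hcyc : ∀ (n : ℕ) (x : Cyc n), x ^ n = 1 := fun n x => by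
    apply Multiplicative.toAdd.injective
    simp
  have hexp : ∀ g : H, g ^ (p * q) = 1 := by
    intro g
    apply e.injective
    rw [map_pow, map_one]
    have h1 : ∀ x : Cyc p, x ^ (p * q) = 1 := fun x => by rw [pow_mul, hcyc, one_pow]
    have h2 : ∀ x : Cyc q, x ^ (p * q) = 1 := fun x => by rw [mul_comm, pow_mul, hcyc, one_pow]
    refine Prod.ext (Prod.ext (h1 _) (Prod.ext (h1 _) (h1 _))) (h2 _)
  have hdq : orderOf d = q := by rw [← Nat.card_zpowers, hd, hcardQ]
  refine ⟨hpq, hcard, hcardP, fun h hh => ?_, hd, ?_, ?_, ?_, ?_⟩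
  · have h1 : orderOf h ∣ p ^ 3 := by
      rw [← hcardP]
      exact Subgroup.orderOf_dvd_natCard (P : Subgroup H) hh
    have h2 : orderOf h ∣ p * q := orderOf_dvd_of_pow_eq_one (hexp h)
    have h3 : (orderOf h).Coprime q := hcop3.of_dvd_left h1
    exact orderOf_dvd_iff_pow_eq_one.1 (h3.dvd_of_dvd_mul_right h2)
  · rw [← hdq, pow_orderOf_eq_one]
  · rintro rfl
    rw [orderOf_one] at hdq
    exact hq.one_lt.ne hdq
  · exact (Subgroup.disjoint_of_coprime_natCard (by rw [hcardP, hcardQ]; exact hcop3)).eq_bot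
  · refine Subgroup.eq_top_of_le_card _ ?_
    rw [hcard]
    refine Nat.le_of_dvd Nat.card_pos (hcop3.mul_dvd_of_dvd_of_dvd ?_ ?_)
    · rw [← hcardP]
      exact Subgroup.card_dvd_of_le le_sup_left
    · have := Subgroup.card_dvd_of_le (le_sup_right : (Q : Subgroup H) ≤ (P : Subgroup H) ⊔ Q)
      rwa [hcardQ] at this

theorem lemma7p5 {p q : ℕ} [Fact p.Prime] [Fact q.Prime] (hpq : p ≠ q)
    {H : Type*} [CommGroup H] [Finite H]
    (hH : Nonempty (H ≃* (Cyc p × Cyc p × Cyc p) × Cyc q))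
    (Hp : Sylow p H) (Hq : Sylow q H)
    (A : SRing H) (hA : A.IsSchurian)
    (hAp : A.IsASubgroup (Hp : Subgroup H)) (hAq : A.IsASubgroup (Hq : Subgroup H))
    (hwr : (A.restrict (Hp : Subgroup H) hAp).Isomorphic
      (((SRing.full (Cyc p)).wreath (SRing.full (Cyc p))).wreath (SRing.full (Cyc p))))
    (hcond : ¬ Group.IsSolvable (inducedGroup A.aut (Hq : Subgroup H)) ∨
      (SRing.transitivityModule
        (inducedGroup (cosetKernel A.aut (Hp : Subgroup H)) (Hp : Subgroup H))
        (rightMultiplications_le_inducedGroup_cosetKernel (rightMultiplications_le_aut A)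
          (Hp : Subgroup H))).IsDecomposable)
    (a b c : (Hp : Subgroup H)) (habc : (A.restrict (Hp : Subgroup H) hAp).IsABasis ![a, b, c])
    (d : H) (hd : Subgroup.zpowers d = (Hq : Subgroup H))
    (f : Equiv.Perm H) (hf : f ∈ A.isoOne)
    (hfa : f a = a) (hfb : f b = b) (hfc : ∃ z ∈ Subgroup.zpowers (a : H), f c = z * c)
    (hfd : f d = d) :
    ∀ X ∈ A.basicSets, f '' X = X := by
  have hs := isCubePrimeSplit_of_sylow hpq hH Hp Hq hd
  obtain ⟨h1, h2, h3, h4, h5, h6, h7, h8⟩ :=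
    SRing.cells_of_isABasis hAp hs.card_left hs.pow_left hwr habc rfl rfl
  have hw : SRing.IsWreathFlag A p (Hp : Subgroup H) _ _ (a : H) (b : H) (c : H) :=
    ⟨rfl, rfl, h1, h2, h3, hs.card_left, h4, h5, hAp, h6, h7, h8⟩
  have hfc' : f c ∈ ((Subgroup.zpowers (a : H) : Subgroup H) : Set H) * {(c : H)} := by
    obtain ⟨z, hz, e⟩ := hfc
    exact ⟨z, hz, c, rfl, e.symm⟩
  intro X hX
  obtain ⟨g, rfl⟩ := SRing.mem_basicSets_iff_exists_cell.1 hX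
  rcases hcond with hns | hdec
  · exact SRing.image_cell_eq_of_forall_mul_mem_cell hs hw hAq hf hfa hfb hfc' hfd
      (fun h hh x hx y hy hx1 hy1 =>
        SRing.mul_mem_cell_of_not_isSolvable hs hw hAq hns hh hx hy hx1 hy1) g
  · exact SRing.image_cell_eq_of_forall_mul_cell_eq hs hw hAq hf hfa hfb hfc' hfd
      (fun v hv hvM => SRing.mul_cell_eq_of_isDecomposable hA hs hw hAq hdec hv hvM) g
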